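/- Let $AP$ be a set of propositions. A transition system $\mathcal S=(S,\to,\lambda)$ over $AP$ consists of a finite set $S$ of states, a left-total relation $\to\ \subseteq S\times S$ and a labeling $\lambda:AP\to 2^S$. A path is a non-empty finite sequence of states $\pi(0)\to\pi(1)\to\dots\to\pi(|\pi|)$ in which consecutive states are related by $\to$ (so $|\pi|=0$ is allowed). For $X\subseteq S$ let $\mathrm{reach}(X)$ (resp. $\mathrm{coreach}(X)$) be the set of states that are the last (resp. first) state of a path whose first (resp. last) state is in $X$. For $\iota,\gamma\in AP$ let $[\![\langle\iota\triangleright\gamma\rangle]\!]$ be the set of paths $\pi$ with $\pi(0)\in\lambda(\iota)$ and $\pi(|\pi|)\in\lambda(\gamma)$. For sets $P,Q$ of paths let $P.Q$ be the set of paths $\pi$ such that for some $0\le i\le|\pi|$ the path $\pi(0)\dots\pi(i)$ is in $P$ and the path $\pi(i)\dots\pi(|\pi|)$ is in $Q$. For $n\ge1$ let $$[\![\mathrm{OR}(\langle\iota_1\triangleright\gamma_1\rangle,\dots,\langle\iota_n\triangleright\gamma_n\rangle)]\!]=\bigcup_{i=1}^n[\![\langle\iota_i\triangleright\gamma_i\rangle]\!],\qquad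 [\![\mathrm{SAND}(\langle\iota_1\triangleright\gamma_1\rangle,\dots,\langle\iota_n\triangleright\gamma_n\rangle)]\!]=[\![\langle\iota_1\triangleright\gamma_1\rangle]\!].\cdots.[\![\langle\iota_n\triangleright\gamma_n\rangle]\!].$$ **Proposition.** For each $\mathrm{OP}\in\{\mathrm{OR},\mathrm{SAND}\}$ the following decision problem is in PTIME: given a transition system $\mathcal S$ (over finitely many propositions, written as an adjacency matrix together with one characteristic vector of states per proposition) and propositions $\iota,\gamma,\iota_1,\gamma_1,\dots,\iota_n,\gamma_n$, $n\ge1$, decide whether $$[\![\mathrm{OP}(\langle\iota_1\triangleright\gamma_1\rangle,\dots,\langle\iota_n\triangleright\gamma_n\rangle)]\!]\subseteq[\![\langle\iota\triangleright\gamma\rangle]\!].$$ Moreover, for every transition system over any set $AP$, every $n\ge1$ and all $\iota,\gamma,\iota_i,\gamma_i\in AP$: (OR) the inclusion holds for $\mathrm{OP}=\mathrm{OR}$ if and only if for all $i\in\{1,\dots,n\}$ $$\lambda(\iota_i)\cap\mathrm{coreach}(\lambda(\gamma_i))\subseteq\lambda(\iota)\quad\text{and}\quad\lambda(\gamma_i)\cap\mathrm{reach}(\lambda(\iota_i))\subseteq\lambda(\gamma);$$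 (SAND) the inclusion holds for $\mathrm{OP}=\mathrm{SAND}$ if and only if no state of $\mathcal S$ satisfies the formula $$\bigl(\neg\iota\wedge\iota_1\wedge \mathrm{EF}(\gamma_1\wedge\iota_2\wedge\mathrm{EF}(\gamma_2\wedge\dots\mathrm{EF}(\gamma_n)))\bigr)\ \vee\ \bigl(\iota_1\wedge \mathrm{EF}(\gamma_1\wedge\iota_2\wedge\mathrm{EF}(\gamma_2\wedge\dots\mathrm{EF}(\gamma_n\wedge\neg\gamma)))\bigr)$$ of the EF-fragment of CTL (literals $p,\neg p$, conjunction, disjunction, EF), where the states satisfying $p$ are those in $\lambda(p)$, the states satisfying $\mathrm{EF}\,\varphi$ are those in the coreach of the set of states satisfying $\varphi$, and $\neg,\wedge,\vee$ are complement, intersection and union. -/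

import Mathlib

/-- A transition system with state set `S`, over the set `AP` of propositions: a left-total
transition relation and a labeling. -/
structure TransitionSystem (S AP : Type*) where
  /-- the transition relation -/
  trans : SetRel S S
  /-- the labeling: `label p` is the set of states labeled by `p` -/
  label : AP → Set S
  /-- the transition relation is left-total -/
  leftTotal : ∀ s, ∃ t, (s, t) ∈ trans

/-- An atomic goal, i.e. a precondition and a postcondition. -/
structure Goal (AP : Type*) where
  /-- the precondition `ι` -/
  pre : AP
  /-- the postcondition `γ` -/
  post : AP

namespace TransitionSystem

variable {S AP : Type*} (T : TransitionSystem S AP)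

/-- A path: a non-empty finite sequence of states in which consecutive states are related by the
transition relation. Its `length` is its number of transitions, `head` and `last` are its two
ends; a path of length `0` is a single state. -/
abbrev Path : Type _ := RelSeries T.trans

/-- The states reachable by a path from a state of `X`. -/
def reach (X : Set S) : Set S :=
  {s | ∃ π : T.Path, π.head ∈ X ∧ π.last = s}

/-- The states from which some path leads to a state of `X`. -/
def coreach (X : Set S) : Set S :=
  {s | ∃ π : T.Path, π.head = s ∧ π.last ∈ X}

/-- Concatenation of two sets of paths: the paths that can be cut at some position `i` into a
prefix in `P` and a suffix in `Q`, which share the state at position `i`. -/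
def concat (P Q : Set T.Path) : Set T.Path :=
  {π | ∃ i : Fin (π.length + 1), π.take i ∈ P ∧ π.drop i ∈ Q}

/-- Path semantics of an atomic goal: the paths from the precondition to the postcondition. -/
def goalSem (g : Goal AP) : Set T.Path :=
  {π | π.head ∈ T.label g.pre ∧ π.last ∈ T.label g.post}

/-- Path semantics of `OR(g, gs…)`: the union of the path semantics of the goals. -/
def orSem (g : Goal AP) (gs : List (Goal AP)) : Set T.Path :=
  ⋃ h ∈ g :: gs, T.goalSem h

/-- Path semantics of `SAND(g, gs…)`: the concatenation, in the given order, of the path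
semantics of the goals. -/
def sandSem : Goal AP → List (Goal AP) → Set T.Path
  | g, [] => T.goalSem g
  | g, h :: gs => T.concat (T.goalSem g) (sandSem h gs)

end TransitionSystem

/-- Formulas of the EF-fragment of CTL: literals, conjunction, disjunction, "eventually". -/
inductive EFFormula (AP : Type*) where
  /-- a proposition -/
  | atom (p : AP)
  /-- a negated proposition -/
  | natom (p : AP)
  /-- conjunction -/
  | and (φ ψ : EFFormula AP)
  /-- disjunction -/
  | or (φ ψ : EFFormula AP)
  /-- "there is a path that eventually reaches" -/
  | ef (φ : EFFormula AP)

namespace EFFormula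

variable {S AP : Type*}

/-- The set of states denoted by a formula in a transition system. -/
def sem (T : TransitionSystem S AP) : EFFormula AP → Set S
  | atom p => T.label p
  | natom p => (T.label p)ᶜ
  | and φ ψ => φ.sem T ∩ ψ.sem T
  | or φ ψ => φ.sem T ∪ ψ.sem T
  | ef φ => T.coreach (φ.sem T)

/-- For goals `(ι₁, γ₁), …, (ιₙ, γₙ)` the formula
`ι₁ ∧ EF (γ₁ ∧ ι₂ ∧ EF (γ₂ ∧ ι₃ ∧ … EF (fin γₙ)))`. -/
def chain (fin : AP → EFFormula AP) : Goal AP → List (Goal AP) → EFFormula AP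
  | g, [] => and (atom g.pre) (ef (fin g.post))
  | g, h :: gs => and (atom g.pre) (ef (and (atom g.post) (chain fin h gs)))

/-- The formula
`(¬ι ∧ ι₁ ∧ EF (γ₁ ∧ ι₂ ∧ … EF γₙ)) ∨ (ι₁ ∧ EF (γ₁ ∧ ι₂ ∧ … EF (γₙ ∧ ¬γ)))`,
where `(ι, γ)` is `goal` and the `(ιᵢ, γᵢ)` are `g :: gs`. -/
def sandFormula (goal g : Goal AP) (gs : List (Goal AP)) : EFFormula AP :=
  or (and (natom goal.pre) (chain atom g gs))
    (chain (fun p => and (atom p) (natom goal.post)) g gs)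

end EFFormula

/-- An input of the decision problems: a transition system with states `0, …, n - 1` over the
propositions `0, …, m - 1`, a goal, and a non-empty list `first :: rest` of goals. -/
structure UnderMatchInput where
  /-- number of states -/
  n : ℕ
  /-- number of propositions -/
  m : ℕ
  /-- the transition system -/
  T : TransitionSystem (Fin n) (Fin m)
  /-- the goal that is refined -/
  goal : Goal (Fin m)
  /-- the first goal under the operator -/
  first : Goal (Fin m)
  /-- the remaining goals under the operator -/
  rest : List (Goal (Fin m))

namespace UnderMatchInput

open Computability (Γ')

/-- A list of bit strings is written by ending each of them by a `comma` and the list by a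
`ket`. -/
def writeBlock : List (List Bool) → List Γ'
  | [] => [Γ'.ket]
  | r :: rs => r.map Γ'.bit ++ Γ'.comma :: writeBlock rs

open Classical in
/-- The adjacency matrix of the transition relation, row by row. -/
noncomputable def matrixRows (I : UnderMatchInput) : List (List Bool) :=
  List.ofFn fun s : Fin I.n => List.ofFn fun t : Fin I.n => decide ((s, t) ∈ I.T.trans)

open Classical in
/-- For each proposition, the characteristic vector of the set of states labeled by it. -/
noncomputable def labelRows (I : UnderMatchInput) : List (List Bool) :=
  List.ofFn fun p : Fin I.m => List.ofFn fun s : Fin I.n => decide (s ∈ I.T.label p)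

/-- The numbers of the propositions of the goals, in unary. -/
def goalRows (I : UnderMatchInput) : List (List Bool) :=
  (I.goal :: I.first :: I.rest).flatMap fun g =>
    [List.replicate g.pre.val true, List.replicate g.post.val true]

/-- The string that encodes an input: adjacency matrix, labeling, goals. -/
noncomputable def encode (I : UnderMatchInput) : List Γ' :=
  writeBlock I.matrixRows ++ writeBlock I.labelRows ++ writeBlock I.goalRows

theorem writeBlock_append_inj {a b : List (List Bool)} {x y : List Γ'}
    (h : writeBlock a ++ x = writeBlock b ++ y) : a = b ∧ x = y := by
  have key : ∀ (r q : List Bool) (u v : List Γ'),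
      r.map Γ'.bit ++ Γ'.comma :: u = q.map Γ'.bit ++ Γ'.comma :: v → r = q ∧ u = v := by
    intro r
    induction r with
    | nil => intro q u v h; cases q <;> simp_all
    | cons c r ih =>
      intro q u v h
      cases q with
      | nil => simp at h
      | cons d q =>
        simp only [List.map_cons, List.cons_append, List.cons.injEq, Γ'.bit.injEq] at h
        obtain ⟨h1, h2⟩ := ih q u v h.2
        exact ⟨by rw [h.1, h1], h2⟩
  induction a generalizing b with
  | nil =>
    cases b with
    | nil => simpa [writeBlock] using h
    | cons q b => cases q <;> simp [writeBlock] at h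
  | cons r a ih =>
    cases b with
    | nil => cases r <;> simp [writeBlock] at h
    | cons q b =>
      simp only [writeBlock, List.append_assoc, List.cons_append] at h
      obtain ⟨h1, h2⟩ := key r q _ _ h
      obtain ⟨h3, h4⟩ := ih h2
      exact ⟨by rw [h1, h3], h4⟩

/-- Different inputs have different encodings. -/
theorem encode_injective : Function.Injective encode := by
  have goals_inj : ∀ (m : ℕ) (l l' : List (Goal (Fin m))),
      (l.flatMap fun g => [List.replicate g.pre.val true, List.replicate g.post.val true]) =
        (l'.flatMap fun g => [List.replicate g.pre.val true, List.replicate g.post.val true]) →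
      l = l' := by
    intro m l
    induction l with
    | nil => intro l' h; cases l' <;> simp_all
    | cons g l ih =>
      intro l' h
      cases l' with
      | nil => simp at h
      | cons g' l' =>
        simp only [List.flatMap_cons, List.cons_append, List.nil_append, List.cons.injEq] at h
        have h1 := congrArg List.length h.1
        have h2 := congrArg List.length h.2.1
        simp only [List.length_replicate] at h1 h2
        obtain ⟨p, q⟩ := g
        obtain ⟨p', q'⟩ := g'
        simp only at h1 h2
        rw [Fin.ext h1, Fin.ext h2, ih l' h.2.2]
  intro I J h
  simp only [encode, List.append_assoc] at h
  obtain ⟨hA, h⟩ := writeBlock_append_inj h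
  obtain ⟨hB, h⟩ := writeBlock_append_inj h
  have hC : I.goalRows = J.goalRows :=
    (writeBlock_append_inj (x := []) (y := []) (by simpa using h)).1
  obtain ⟨n, m, ⟨tr, lb, lt⟩, g, f, r⟩ := I
  obtain ⟨n', m', ⟨tr', lb', lt'⟩, g', f', r'⟩ := J
  have hn : n = n' := by simpa [matrixRows] using congrArg List.length hA
  have hm : m = m' := by simpa [labelRows] using congrArg List.length hB
  subst hn hm
  have htr : tr = tr' := by
    ext ⟨s, t⟩
    have := congrFun (List.ofFn_injective (congrFun (List.ofFn_injective hA) s)) t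
    simpa using this
  have hlb : lb = lb' := by
    funext p
    ext s
    have := congrFun (List.ofFn_injective (congrFun (List.ofFn_injective hB) p)) s
    simpa using this
  have hg := goals_inj _ _ _ hC
  simp only [List.cons.injEq] at hg
  obtain ⟨rfl, rfl, rfl⟩ := hg
  subst htr hlb
  rfl

/-- The input has the property `⟦OR(first, rest…)⟧ ⊆ ⟦goal⟧`. -/
def OrUnderMatch (I : UnderMatchInput) : Prop :=
  I.T.orSem I.first I.rest ⊆ I.T.goalSem I.goal

/-- The input has the property `⟦SAND(first, rest…)⟧ ⊆ ⟦goal⟧`. -/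
def SandUnderMatch (I : UnderMatchInput) : Prop :=
  I.T.sandSem I.first I.rest ⊆ I.T.goalSem I.goal

end UnderMatchInput

open Classical in
/-- The decision problem `P`, on inputs that are written as strings by `enc`, is in PTIME: some
(multi-stack) Turing machine, given the string of any input `a`, halts with the answer whether
`P a` holds, after a number of steps bounded by a polynomial in the length of the string. -/
def InPTIME {α Γ : Type} (enc : α → List Γ) (P : α → Prop) : Prop :=
  Nonempty (Turing.TM2ComputableInPolyTime enc Computability.encodeBool fun a => decide (P a))

/-! Membership of a path in the semantics of an atomic goal depends only on its two end states. So
an inclusion fails exactly when some path of the composed goal starts outside the refined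
precondition or ends outside the refined postcondition, and only the pairs (first state, last state)
matter. For `OR` this is checked goal by goal (`goalSem_subset_iff`). For `SAND`, gluing paths at a
common state shows that the end pairs of a concatenation are composed relationally
(`exists_mem_concat_goalSem`). Read backwards, this gives the nested `EF` formula (`mem_sem_chain`);
read forwards, it gives iterated images of sets of states (`mem_imageList`).

The polynomial algorithm uses the forward reading. It propagates two sets through the goals: the
states reached from outside the refined precondition, and the states reached from anywhere. A goal
acts on a set by intersecting with its precondition, closing under reachability, and intersecting
with its postcondition. The inclusion holds iff the first set ends up empty and the second lies
inside the refined postcondition (`sandSem_subset_iff_imageList`). Reachability takes as many rounds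
of adding successors as there are states (`iterate_expand_eq_reach`). `OR` treats each goal as a
one-goal `SAND`, restarting both sets and accumulating violations.

To obtain an actual Turing machine, the algorithm is written in a small language of stack programs.
`Runs` is a compositional statement of result and running time, and `InPTIME.of_runs` compiles a
program to a machine. One program `decideProg op` serves both problems; `runs_decideProg` bounds its
time by a cubic polynomial, and the invariant `Marks` relates its cells to sets of states. -/

/-! ### A structured programming language for multi-stack machines -/

/-- Structured programs that operate on stacks indexed by `K`, with alphabets `Γ k`. -/
inductive StackProg {K : Type} (Γ : K → Type) : Type
  /-- do nothing -/
  | skip : StackProg Γ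
  /-- push a symbol -/
  | push (k : K) (a : Γ k) : StackProg Γ
  /-- run two programs in sequence -/
  | seq (p q : StackProg Γ) : StackProg Γ
  /-- pop a symbol, run the body that belongs to it, and repeat if `cont` says so -/
  | loop (k : K) (body : Option (Γ k) → StackProg Γ) (cont : Option (Γ k) → Bool) : StackProg Γ

namespace StackProg

variable {K : Type} {Γ : K → Type}

/-- The control points of a program. -/
def Lab : StackProg Γ → Type
  | skip => Unit
  | push _ _ => Unit
  | seq p q => Lab p ⊕ Lab q
  | loop _ body _ => Unit ⊕ Σ o, Lab (body o)

theorem finite_lab [∀ k, Finite (Γ k)] : ∀ p : StackProg Γ, Finite (Lab p)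
  | skip => inferInstanceAs (Finite Unit)
  | push _ _ => inferInstanceAs (Finite Unit)
  | seq p q => by
    have := finite_lab p
    have := finite_lab q
    exact inferInstanceAs (Finite (Lab p ⊕ Lab q))
  | loop k body _ => by
    have := fun o => finite_lab (body o)
    exact inferInstanceAs (Finite (Unit ⊕ Σ o, Lab (body o)))

/-- The control point at which a program starts. -/
def entry : ∀ p : StackProg Γ, Lab p
  | skip => ()
  | push _ _ => ()
  | seq p _ => Sum.inl (entry p)
  | loop _ _ _ => Sum.inl ()

/-- The registers of the machine: one for each stack, for the symbol that was last popped. -/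
abbrev Reg (Γ : K → Type) : Type := ∀ k, Option (Γ k)

variable [DecidableEq K]

/-- The machine code of a program, with control points embedded by `emb` and with a jump to
`exit` at the end. -/
def code {Λ : Type} : ∀ (p : StackProg Γ), (Lab p → Λ) → Λ → Lab p → Turing.TM2.Stmt Γ Λ (Reg Γ)
  | skip, _, exit, _ => .goto fun _ => exit
  | push k a, _, exit, _ => .push k (fun _ => a) (.goto fun _ => exit)
  | seq p q, emb, _, Sum.inl l => code p (emb ∘ Sum.inl) (emb (Sum.inr (entry q))) l
  | seq _ q, emb, exit, Sum.inr l => code q (emb ∘ Sum.inr) exit l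
  | loop k body _, emb, _, Sum.inl _ =>
      .pop k (fun v o => Function.update v k o) 
        (.goto fun v => emb (Sum.inr ⟨v k, entry (body (v k))⟩))
  | loop _ body cont, emb, exit, Sum.inr ⟨o, l⟩ =>
      code (body o) (fun l => emb (Sum.inr ⟨o, l⟩)) (if cont o then emb (Sum.inl ()) else exit) l

/-- The contents of all stacks. -/
abbrev Store (Γ : K → Type) : Type := ∀ k, List (Γ k)

/-- Started on the stacks `s`, the program `p` ends with the stacks `s'` after at most `T` steps. -/
def Runs (p : StackProg Γ) (s s' : Store Γ) (T : ℕ) : Prop :=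
  ∀ ⦃Λ : Type⦄ (M : Λ → Turing.TM2.Stmt Γ Λ (Reg Γ)) (emb : Lab p → Λ) (exit : Λ),
    (∀ l, M (emb l) = code p emb exit l) → ∀ v, ∃ v', ∃ t ≤ T,
      (flip bind (Turing.TM2.step M))^[t] (some ⟨some (emb (entry p)), v, s⟩) =
        some ⟨some exit, v', s'⟩

namespace Runs

variable {s s' s₁ s₂ s₃ : Store Γ} {p q : StackProg Γ} {T T₁ T₂ : ℕ}

theorem mono (h : Runs p s s' T₁) (hT : T₁ ≤ T₂) : Runs p s s' T₂ := by
  intro Λ M emb exit hM v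
  obtain ⟨v', t, ht, h⟩ := h M emb exit hM v
  exact ⟨v', t, ht.trans hT, h⟩

theorem skip (s : Store Γ) : Runs .skip s s 1 := by
  intro Λ M emb exit hM v
  refine ⟨v, 1, le_rfl, ?_⟩
  simp [flip, hM, code]

theorem push (s : Store Γ) (k : K) (a : Γ k) :
    Runs (.push k a) s (Function.update s k (a :: s k)) 1 := by
  intro Λ M emb exit hM v
  refine ⟨v, 1, le_rfl, ?_⟩
  simp [flip, hM, code]

/-- `Runs` quantifies over the host machine, the embedding of control points, the exit and the
initial registers. Hence each part can be run inside the code of the whole, with the entry of `q` as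
the exit of `p`. -/
theorem seq (hp : Runs p s₁ s₂ T₁) (hq : Runs q s₂ s₃ T₂) : Runs (.seq p q) s₁ s₃ (T₁ + T₂) := by
  intro Λ M emb exit hM v
  obtain ⟨v₁, t₁, ht₁, h₁⟩ := hp M (emb ∘ Sum.inl) (emb (Sum.inr (entry q)))
    (fun l => hM (Sum.inl l)) v
  obtain ⟨v₂, t₂, ht₂, h₂⟩ := hq M (emb ∘ Sum.inr) exit (fun l => hM (Sum.inr l)) v₁
  refine ⟨v₂, t₂ + t₁, by omega, ?_⟩
  rw [Function.iterate_add_apply]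
  exact (congrArg _ h₁).trans h₂

variable {k : K} {body : Option (Γ k) → StackProg Γ} {cont : Option (Γ k) → Bool}

/-- `Turing.TM2.step` executes a statement up to its `goto`. Popping, saving the symbol in the
register and branching on it therefore cost one step together; `head?` and `tail` also cover the
empty stack. -/
theorem step_loop {Λ : Type} {M : Λ → Turing.TM2.Stmt Γ Λ (Reg Γ)} {l : Λ}
    {next : Option (Γ k) → Λ}
    (hM : M l = .pop k (fun v o => Function.update v k o) (.goto fun v => next (v k)))
    (v : Reg Γ) (s : Store Γ) :
    (flip bind (Turing.TM2.step M))^[1] (some ⟨some l, v, s⟩) =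
      some ⟨some (next (s k).head?), Function.update v k (s k).head?,
        Function.update s k (s k).tail⟩ := by
  simp [flip, hM]

theorem loop_exit (hc : cont (s k).head? = false)
    (h : Runs (body (s k).head?) (Function.update s k (s k).tail) s' T) :
    Runs (.loop k body cont) s s' (T + 1) := by
  intro Λ M emb exit hM v
  obtain ⟨v', t, ht, h⟩ := h M (fun l => emb (Sum.inr ⟨(s k).head?, l⟩)) exit
    (fun l => (hM (Sum.inr ⟨_, l⟩)).trans (by simp only [code, hc]; rfl))
    (Function.update v k (s k).head?)
  refine ⟨v', t + 1, by omega, ?_⟩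
  rw [Function.iterate_add_apply, ← h]
  congr 1
  exact step_loop (next := fun o => emb (Sum.inr ⟨o, entry (body o)⟩)) (hM (Sum.inl ())) v s

theorem loop_cont (hc : cont (s₁ k).head? = true)
    (h : Runs (body (s₁ k).head?) (Function.update s₁ k (s₁ k).tail) s₂ T₁)
    (h' : Runs (.loop k body cont) s₂ s₃ T₂) :
    Runs (.loop k body cont) s₁ s₃ (T₁ + 1 + T₂) := by
  intro Λ M emb exit hM v
  obtain ⟨v', t, ht, h⟩ := h M (fun l => emb (Sum.inr ⟨(s₁ k).head?, l⟩)) (emb (Sum.inl ()))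
    (fun l => (hM (Sum.inr ⟨_, l⟩)).trans (by simp only [code, hc]; rfl))
    (Function.update v k (s₁ k).head?)
  obtain ⟨v'', t', ht', h'⟩ := h' M emb exit hM v'
  refine ⟨v'', t' + (t + 1), by omega, ?_⟩
  rw [Function.iterate_add_apply, Function.iterate_add_apply, ← h']
  congr 1
  refine Eq.trans ?_ h
  congr 1
  exact step_loop (next := fun o => emb (Sum.inr ⟨o, entry (body o)⟩)) (hM (Sum.inl ())) v s₁

end Runs

/-- The store in which only the stack `k` is non-empty. -/
def single (k : K) (l : List (Γ k)) : Store Γ := Function.update (fun _ => []) k l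

theorem single_self (k : K) (l : List (Γ k)) : single k l k = l :=
  Function.update_self ..

theorem single_of_ne {k k' : K} (h : k' ≠ k) (l : List (Γ k)) : single k l k' = [] :=
  Function.update_of_ne h ..

/-! ### Compilation of programs to Turing machines -/

variable [Fintype K] [∀ k, Fintype (Γ k)]

/-- The machine that runs a program, resets its registers and halts. -/
noncomputable def machine (p : StackProg Γ) (inp out : K) : Turing.FinTM2 where
  K := K
  k₀ := inp
  k₁ := out
  Γ := Γ
  Λ := Option (Lab p)
  main := some (entry p)
  ΛFin := haveI := finite_lab p; Fintype.ofFinite _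
  σ := Reg Γ
  initialState := fun _ => none
  σFin := inferInstanceAs (Fintype (∀ k, Option (Γ k)))
  Γk₀Fin := inferInstance
  m
    | none => .load (fun _ _ => none) .halt
    | some l => code p some none l

theorem initList_machine (p : StackProg Γ) (inp out : K) (l : List (Γ inp)) :
    Turing.initList (p.machine inp out) l =
      (⟨some (some (entry p)), fun _ => none, single inp l⟩ :
        Turing.TM2.Cfg Γ (Option (Lab p)) (Reg Γ)) := by
  unfold Turing.initList
  congr 1
  funext (k : K)
  by_cases h : k = inp
  · cases h
    exact (dif_pos rfl).trans (single_self ..).symm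
  · exact (dif_neg h).trans (single_of_ne h _).symm

theorem haltList_machine (p : StackProg Γ) (inp out : K) (l : List (Γ out)) :
    Turing.haltList (p.machine inp out) l =
      (⟨none, fun _ => none, single out l⟩ :
        Turing.TM2.Cfg Γ (Option (Lab p)) (Reg Γ)) := by
  unfold Turing.haltList
  congr 1
  funext (k : K)
  by_cases h : k = out
  · cases h
    exact (dif_pos rfl).trans (single_self ..).symm
  · exact (dif_neg h).trans (single_of_ne h _).symm

/-- The extra step is taken at the label `none`: it resets the registers, because the prescribed
halting configuration contains the initial internal state. -/
theorem outputs_machine {p : StackProg Γ} {inp out : K} {l : List (Γ inp)} {l' : List (Γ out)}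
    {T : ℕ} (h : Runs p (single inp l) (single out l') T) :
    Nonempty (Turing.TM2OutputsInTime (p.machine inp out) l (some l') (T + 1)) := by
  obtain ⟨v', t, ht, h⟩ := h (p.machine inp out).m some none (fun _ => rfl) (fun _ => none)
  refine ⟨⟨⟨t + 1, ?_⟩, Nat.succ_le_succ ht⟩⟩
  rw [initList_machine, Nat.add_comm, Function.iterate_add_apply]
  exact (congrArg _ h).trans (congrArg some (haltList_machine p inp out l').symm)

end StackProg

/-- A predicate that is decided by a program within a polynomial time bound is in PTIME. -/
theorem InPTIME.of_runs {α K : Type} [DecidableEq K] [Fintype K] {Γ : K → Type}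
    [∀ k, Fintype (Γ k)] {inp out : K} (hout : Γ out = Bool) (enc : α → List (Γ inp)) (P : α → Prop)
    (p : StackProg Γ) (time : Polynomial ℕ)
    (h : ∀ a, ∃ b : Bool, (b = true ↔ P a) ∧
      p.Runs (StackProg.single inp (enc a)) (StackProg.single out [cast hout.symm b])
        (time.eval (enc a).length)) :
    InPTIME enc P := by
  classical
  refine ⟨{
    tm := p.machine inp out
    inputAlphabet := Equiv.refl _
    outputAlphabet := Equiv.cast hout
    time := time + 1
    outputsFun := fun a => Classical.choice ?_ }⟩
  obtain ⟨b, hb, hr⟩ := h a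
  have hb' : decide (P a) = b := by
    cases b <;> simp_all
  have := StackProg.outputs_machine hr
  have e1 : List.map (Equiv.refl (Γ inp)).invFun (enc a) = enc a := List.map_id _
  rw [hb', Polynomial.eval_add, Polynomial.eval_one]
  erw [e1]
  exact this

/-! ### Paths, reachability and the path semantics -/

theorem RelSeries.drop_smash {α : Type*} {r : SetRel α α} (p q : RelSeries r)
    (h : p.last = q.head) (hi : p.length < (p.smash q h).length + 1) :
    (p.smash q h).drop ⟨p.length, hi⟩ = q := by
  have hlen : ((p.smash q h).drop ⟨p.length, hi⟩).length = q.length := by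
    simp [RelSeries.drop, RelSeries.smash]
  refine RelSeries.ext hlen ?_
  funext ⟨j, hj⟩
  rw [hlen] at hj
  -- `smash_natAdd` speaks only of the states of `q` before the last one; the final index is settled
  -- by comparing last states.
  rcases Nat.lt_or_ge j q.length with hj' | hj'
  · exact (congrArg (p.smash q h).toFun (Fin.ext (Nat.add_comm j p.length))).trans (RelSeries.smash_natAdd h ⟨j, hj'⟩)
  · obtain rfl : j = q.length := by omega
    have := RelSeries.last_drop (p.smash q h) ⟨p.length, hi⟩
    rw [RelSeries.last_smash] at this
    refine Eq.trans ?_ this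
    exact congrArg _ (Fin.ext hlen.symm)

namespace TransitionSystem

variable {S AP : Type*} (T : TransitionSystem S AP)

/-- The prefix of the glued path is only known here through its end states. Asking that `P` contain
every path with these ends is harmless, since it is applied to the semantics of a goal. -/
theorem mem_concat_of_smash {P Q : Set T.Path} {π ρ : T.Path} (h : π.last = ρ.head)
    (hP : ∀ σ : T.Path, σ.head = π.head → σ.last = π.last → σ ∈ P) (hQ : ρ ∈ Q) :
    π.smash ρ h ∈ T.concat P Q := by
  have hi : π.length < (π.smash ρ h).length + 1 := by simp [RelSeries.smash]
  refine ⟨⟨π.length, hi⟩, hP _ ?_ ?_, ?_⟩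
  · rw [RelSeries.head_take, RelSeries.head_smash]
  · rw [RelSeries.last_take]
    exact RelSeries.smash_castLE h (Fin.last _)
  · rwa [RelSeries.drop_smash]

/-- The possible ends of a path of `concat (goalSem g) Q`. -/
theorem exists_mem_concat_goalSem (g : Goal AP) (Q : Set T.Path) (s t : S) :
    (∃ π ∈ T.concat (T.goalSem g) Q, π.head = s ∧ π.last = t) ↔
      ∃ u, s ∈ T.label g.pre ∧ u ∈ T.label g.post ∧ (∃ π : T.Path, π.head = s ∧ π.last = u) ∧
        ∃ ρ ∈ Q, ρ.head = u ∧ ρ.last = t := by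
  constructor
  · rintro ⟨π, ⟨i, ⟨h1, h2⟩, h3⟩, rfl, rfl⟩
    refine ⟨π i, by simpa using h1, by simpa using h2, ⟨π.take i, by simp, by simp⟩,
      π.drop i, h3, by simp, by simp⟩
  · rintro ⟨u, h1, h2, ⟨π, rfl, rfl⟩, ρ, hρ, h3, rfl⟩
    exact ⟨π.smash ρ h3.symm, T.mem_concat_of_smash h3.symm
      (fun σ h4 h5 => ⟨h4 ▸ h1, h5 ▸ h2⟩) hρ, by simp, by simp⟩

theorem exists_mem_goalSem (g : Goal AP) (s t : S) :
    (∃ π ∈ T.goalSem g, π.head = s ∧ π.last = t) ↔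
      s ∈ T.label g.pre ∧ t ∈ T.label g.post ∧ ∃ π : T.Path, π.head = s ∧ π.last = t := by
  constructor
  · rintro ⟨π, ⟨h1, h2⟩, rfl, rfl⟩
    exact ⟨h1, h2, π, rfl, rfl⟩
  · rintro ⟨h1, h2, π, rfl, rfl⟩
    exact ⟨π, ⟨h1, h2⟩, rfl, rfl⟩

/-- The chain formula holds at the first states of the paths of `SAND` whose last state satisfies
the property that `fin` adds to the last postcondition. -/
theorem mem_sem_chain {fin : AP → EFFormula AP} {X : Set S}
    (hfin : ∀ p, (fin p).sem T = T.label p ∩ X) (g : Goal AP) (gs : List (Goal AP)) (s : S) :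
    s ∈ (EFFormula.chain fin g gs).sem T ↔
      ∃ t ∈ X, ∃ π ∈ T.sandSem g gs, π.head = s ∧ π.last = t := by
  induction gs generalizing g s with
  | nil =>
    simp only [EFFormula.chain, EFFormula.sem, hfin, sandSem, exists_mem_goalSem, coreach,
      Set.mem_inter_iff, Set.mem_ofPred_eq]
    constructor
    · rintro ⟨h1, π, h2, h3, h4⟩
      exact ⟨_, h4, h1, h3, π, h2, rfl⟩
    · rintro ⟨t, h4, h1, h3, π, h2, rfl⟩
      exact ⟨h1, π, h2, h3, h4⟩
  | cons h gs ih =>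
    simp only [EFFormula.chain, EFFormula.sem, sandSem, exists_mem_concat_goalSem, coreach,
      Set.mem_inter_iff, Set.mem_ofPred_eq, ih]
    constructor
    · rintro ⟨h1, π, h2, h3, t, ht, ρ, hρ⟩
      exact ⟨t, ht, _, h1, h3, ⟨π, h2, rfl⟩, ρ, hρ⟩
    · rintro ⟨t, ht, u, h1, h3, ⟨π, h2, rfl⟩, ρ, hρ⟩
      exact ⟨h1, π, h2, h3, t, ht, ρ, hρ⟩

/-- The disjuncts of the formula collect the first states of the two kinds of violating paths.
`mem_sem_chain` applies with no condition on the last state for the first, and with the complement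
of the refined postcondition for the second. -/
theorem sandSem_subset_iff_formula (goal g : Goal AP) (gs : List (Goal AP)) :
    T.sandSem g gs ⊆ T.goalSem goal ↔ (EFFormula.sandFormula goal g gs).sem T = ∅ := by
  have h1 : ∀ p, (EFFormula.atom p).sem T = T.label p ∩ Set.univ := fun p => by
    simp [EFFormula.sem]
  have h2 : ∀ p, (EFFormula.and (.atom p) (.natom goal.post)).sem T =
      T.label p ∩ (T.label goal.post)ᶜ := fun p => rfl
  rw [Set.eq_empty_iff_forall_notMem]
  simp only [EFFormula.sandFormula, EFFormula.sem, Set.mem_union, Set.mem_inter_iff,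
    T.mem_sem_chain h1, T.mem_sem_chain h2, Set.mem_compl_iff]
  constructor
  · rintro h s (⟨h3, t, -, π, hπ, rfl, rfl⟩ | ⟨t, ht, π, hπ, rfl, rfl⟩)
    · exact h3 (h hπ).1
    · exact ht (h hπ).2
  · intro h π hπ
    by_contra hn
    refine h π.head ?_
    rcases not_and_or.mp hn with hn | hn
    · exact Or.inl ⟨hn, _, trivial, π, hπ, rfl, rfl⟩
    · exact Or.inr ⟨_, hn, π, hπ, rfl, rfl⟩

theorem orSem_subset_iff_forall (goal g : Goal AP) (gs : List (Goal AP)) :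
    T.orSem g gs ⊆ T.goalSem goal ↔ ∀ h ∈ g :: gs, T.goalSem h ⊆ T.goalSem goal := by
  simp only [orSem, Set.iUnion_subset_iff]

theorem goalSem_subset_iff (goal h : Goal AP) :
    T.goalSem h ⊆ T.goalSem goal ↔
      T.label h.pre ∩ T.coreach (T.label h.post) ⊆ T.label goal.pre ∧
        T.label h.post ∩ T.reach (T.label h.pre) ⊆ T.label goal.post := by
  constructor
  · intro H
    refine ⟨?_, ?_⟩
    · rintro s ⟨h1, π, rfl, h2⟩
      exact (H (show π ∈ T.goalSem h from ⟨h1, h2⟩)).1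
    · rintro s ⟨h1, π, h2, rfl⟩
      exact (H (show π ∈ T.goalSem h from ⟨h2, h1⟩)).2
  · rintro ⟨h1, h2⟩ π ⟨h3, h4⟩
    exact ⟨h1 ⟨h3, π, rfl, h4⟩, h2 ⟨h4, π, h3, rfl⟩⟩

/-! ### Forward images of sets of states -/

/-- The last states of the paths of `g` that start in `A`. -/
def image (g : Goal AP) (A : Set S) : Set S :=
  T.reach (A ∩ T.label g.pre) ∩ T.label g.post

/-- The last states of the paths of `SAND` of a list of goals that start in `A`. -/
def imageList (A : Set S) : List (Goal AP) → Set S :=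
  List.foldl (fun A g => T.image g A) A

/-- The induction varies `A`: after the first goal, its image is the set of starts for the remaining
goals. -/
theorem mem_imageList (g : Goal AP) (gs : List (Goal AP)) (A : Set S) (t : S) :
    t ∈ T.imageList A (g :: gs) ↔ ∃ s ∈ A, ∃ π ∈ T.sandSem g gs, π.head = s ∧ π.last = t := by
  induction gs generalizing g A with
  | nil =>
    simp only [imageList, List.foldl_cons, List.foldl_nil, image, sandSem, exists_mem_goalSem,
      reach, Set.mem_inter_iff, Set.mem_ofPred_eq]
    constructor
    · rintro ⟨⟨π, ⟨h1, h2⟩, h3⟩, h4⟩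
      exact ⟨_, h1, h2, h4, π, rfl, h3⟩
    · rintro ⟨_, h1, h2, h4, π, rfl, h3⟩
      exact ⟨⟨π, ⟨h1, h2⟩, h3⟩, h4⟩
  | cons h gs ih =>
    have : T.imageList A (g :: h :: gs) = T.imageList (T.image g A) (h :: gs) := rfl
    rw [this, ih]
    simp only [sandSem, exists_mem_concat_goalSem, image, reach, Set.mem_inter_iff,
      Set.mem_ofPred_eq]
    constructor
    · rintro ⟨u, ⟨⟨π, ⟨h1, h2⟩, h3⟩, h4⟩, ρ⟩
      exact ⟨_, h1, u, h2, h4, ⟨π, rfl, h3⟩, ρ⟩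
    · rintro ⟨_, h1, u, h2, h4, ⟨π, rfl, h3⟩, ρ⟩
      exact ⟨u, ⟨⟨π, ⟨h1, h2⟩, h3⟩, h4⟩, ρ⟩

/-- The inclusion fails at `s` if `s` is the last state of a path of `SAND` that starts outside
the precondition of `goal`, or of a path that ends outside its postcondition. -/
theorem sandSem_subset_iff_imageList (goal g : Goal AP) (gs : List (Goal AP)) :
    T.sandSem g gs ⊆ T.goalSem goal ↔
      ∀ s, s ∉ T.imageList (T.label goal.pre)ᶜ (g :: gs) ∧
        (s ∈ T.imageList Set.univ (g :: gs) → s ∈ T.label goal.post) := by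
  simp only [mem_imageList]
  constructor
  · intro H s
    constructor
    · rintro ⟨t, ht, π, hπ, rfl, rfl⟩
      exact ht (H hπ).1
    · rintro ⟨t, -, π, hπ, rfl, rfl⟩
      exact (H hπ).2
  · intro H π hπ
    refine ⟨?_, (H π.last).2 ⟨_, trivial, π, hπ, rfl, rfl⟩⟩
    by_contra h
    exact (H π.last).1 ⟨_, h, π, hπ, rfl, rfl⟩

/-! ### Reachability as iterated one-step closure -/

/-- The states of `A` and their successors. -/
def expand (A : Set S) : Set S :=
  A ∪ {t | ∃ s ∈ A, (s, t) ∈ T.trans}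

theorem subset_expand (A : Set S) : A ⊆ T.expand A := Set.subset_union_left

theorem iterate_expand_subset_reach (A : Set S) (k : ℕ) : T.expand^[k] A ⊆ T.reach A := by
  induction k with
  | zero => exact fun s hs => ⟨RelSeries.singleton _ s, hs, rfl⟩
  | succ k ih =>
    rw [Function.iterate_succ_apply']
    rintro t (ht | ⟨s, hs, hst⟩)
    · exact ih ht
    · obtain ⟨π, h1, rfl⟩ := ih hs
      exact ⟨π.snoc t hst, by simpa using h1, by simp⟩

theorem reach_subset_of_closed {A B : Set S} (hAB : A ⊆ B)
    (hB : ∀ s ∈ B, ∀ t, (s, t) ∈ T.trans → t ∈ B) : T.reach A ⊆ B := by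
  rintro _ ⟨π, hπ, rfl⟩
  have key : ∀ i, (hi : i < π.length + 1) → π ⟨i, hi⟩ ∈ B := by
    intro i
    induction i with
    | zero => exact fun _ => hAB hπ
    | succ i ih =>
      intro hi
      exact hB _ (ih (by omega)) _ (π.step ⟨i, by omega⟩)
  exact key π.length (by omega)

/-- The cardinalities of the iterates increase, are bounded by that of `S`, and stay constant once
two consecutive ones agree. So they are stable from `Nat.card S` on, and a stable iterate is closed
under transitions. -/
theorem iterate_expand_eq_reach [Finite S] (A : Set S) {n : ℕ} (hn : Nat.card S ≤ n) :
    T.expand^[n] A = T.reach A := by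
  refine (T.iterate_expand_subset_reach A n).antisymm ?_
  have hmono : Monotone fun k => T.expand^[k] A := monotone_nat_of_le_succ fun k => by
    rw [Function.iterate_succ_apply']
    exact T.subset_expand _
  have hstab : T.expand^[n + 1] A = T.expand^[n] A := by
    have hcard : ∀ {B C : Set S}, B ⊆ C → B.ncard = C.ncard → B = C := fun h1 h2 =>
      Set.eq_of_subset_of_ncard_le h1 h2.ge (Set.toFinite _)
    have key : ∀ m, Nat.card S ≤ m →
        (T.expand^[m] A).ncard = (T.expand^[Nat.card S] A).ncard := fun m hm =>
      Nat.stabilises_of_monotone (f := fun k => (T.expand^[k] A).ncard)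
        (fun a b hab => Set.ncard_le_ncard (hmono hab) (Set.toFinite _))
        (fun m => Set.ncard_le_card _)
        -- Nested iterates of equal cardinality are equal sets, so applying `expand` once more
        -- changes nothing either.
        (fun m hm => by
          have := hcard (hmono (Nat.le_succ m)) hm
          simp only [Function.iterate_succ_apply'] at this ⊢
          rw [← this, ← this]) hm
    exact (hcard (hmono (Nat.le_succ n)) ((key n hn).trans (key (n + 1) (by omega)).symm)).symm
  refine T.reach_subset_of_closed (hmono (Nat.zero_le n)) fun s hs t hst => ?_
  rw [← hstab, Function.iterate_succ_apply']
  exact Or.inr ⟨s, hs, hst⟩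

end TransitionSystem

/-! ### Loops that empty, move and duplicate stacks -/

namespace StackProg

variable {K : Type} {Γ : K → Type}

/-- Empty the stack `k`. -/
def clear (k : K) : StackProg Γ :=
  .loop k (fun _ => .skip) Option.isSome

/-- Move the stack `j` on top of the stack `k`, in reversed order. -/
def move (j k : K) (f : Γ j → Γ k) : StackProg Γ :=
  .loop j (fun o => o.elim .skip fun a => .push k (f a)) Option.isSome

/-- Move the stack `j` on top of each of the stacks `k` and `k'`, in reversed order. -/
def moveTwo (j k k' : K) (f : Γ j → Γ k) (f' : Γ j → Γ k') : StackProg Γ :=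
  .loop j (fun o => o.elim .skip fun a => .seq (.push k (f a)) (.push k' (f' a))) Option.isSome

variable [DecidableEq K]

namespace Runs

theorem conv {p : StackProg Γ} {s s' s'' : Store Γ} {T T' : ℕ} (h : Runs p s s' T) (hs : s' = s'')
    (hT : T ≤ T') : Runs p s s'' T' :=
  hs ▸ h.mono hT

section rules

variable {s s' s₂ : Store Γ} {k : K} {body : Option (Γ k) → StackProg Γ}
  {cont : Option (Γ k) → Bool} {a : Γ k} {l : List (Γ k)} {T T' : ℕ}

theorem loop_nil (hs : s k = []) (hc : cont none = false) (h : Runs (body none) s s' T) :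
    Runs (.loop k body cont) s s' (T + 1) := by
  have hu : Function.update s k (s k).tail = s := by
    rw [hs, List.tail_nil, ← hs, Function.update_eq_self]
  refine loop_exit (by rwa [hs]) ?_
  rw [hu, hs]
  exact h

theorem loop_last (hs : s k = a :: l) (hc : cont (some a) = false)
    (h : Runs (body (some a)) (Function.update s k l) s' T) :
    Runs (.loop k body cont) s s' (T + 1) := by
  refine loop_exit (by rwa [hs]) ?_
  rw [hs]
  exact h

theorem loop_cons (hs : s k = a :: l) (hc : cont (some a) = true)
    (h : Runs (body (some a)) (Function.update s k l) s₂ T)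
    (h' : Runs (.loop k body cont) s₂ s' T') :
    Runs (.loop k body cont) s s' (T + 1 + T') := by
  refine loop_cont (by rwa [hs]) ?_ h'
  rw [hs]
  exact h

end rules

/-- Each round costs one step for the pop and one for the body, and there is a final round in which
the pop finds the stack empty. -/
theorem clear (s : Store Γ) (k : K) :
    Runs (clear k) s (Function.update s k []) (2 * (s k).length + 2) := by
  induction h : s k generalizing s with
  | nil =>
    refine (loop_nil h rfl (Runs.skip s)).conv ?_ le_rfl
    rw [← h, Function.update_eq_self]
  | cons a l ih =>
    refine (loop_cons h rfl (Runs.skip _) (ih _ (Function.update_self ..))).conv ?_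
      (by simp only [List.length_cons]; omega)
    rw [Function.update_idem]

theorem move {j k : K} (hjk : j ≠ k) (f : Γ j → Γ k) (s : Store Γ) :
    Runs (move j k f) s
      (Function.update (Function.update s j []) k (((s j).map f).reverse ++ s k))
      (2 * (s j).length + 2) := by
  induction h : s j generalizing s with
  | nil =>
    refine (loop_nil h rfl (Runs.skip s)).conv ?_ le_rfl
    rw [← h, Function.update_eq_self]
    simp only [h, List.map_nil, List.reverse_nil, List.nil_append, Function.update_eq_self]
  | cons a l ih =>
    have := ih (Function.update (Function.update s j l) k
      (f a :: (Function.update s j l) k)) (by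
        rw [Function.update_of_ne hjk, Function.update_self])
    refine (loop_cons h rfl (Runs.push _ _ _) this).conv ?_
      (by simp only [List.length_cons]; omega)
    funext i
    by_cases hk : i = k
    · subst hk
      simp [hjk.symm]
    · by_cases hj : i = j
      · subst hj
        simp [hjk]
      · simp [hk, hj]

theorem moveTwo {j k k' : K} (hjk : j ≠ k) (hjk' : j ≠ k') (hkk' : k ≠ k') (f : Γ j → Γ k)
    (f' : Γ j → Γ k') (s : Store Γ) :
    Runs (moveTwo j k k' f f') s
      (Function.update (Function.update (Function.update s j [])
        k (((s j).map f).reverse ++ s k)) k' (((s j).map f').reverse ++ s k'))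
      (3 * (s j).length + 2) := by
  induction h : s j generalizing s with
  | nil =>
    refine (loop_nil h rfl (Runs.skip s)).conv ?_ le_rfl
    rw [← h, Function.update_eq_self]
    simp only [h, List.map_nil, List.reverse_nil, List.nil_append, Function.update_eq_self]
  | cons a l ih =>
    have := ih (Function.update (Function.update (Function.update s j l) k
      (f a :: (Function.update s j l) k)) k' (f' a :: (Function.update (Function.update s j l) k
      (f a :: (Function.update s j l) k)) k')) (by
        rw [Function.update_of_ne hjk', Function.update_of_ne hjk, Function.update_self])
    refine (loop_cons h rfl (.seq (Runs.push _ _ _) (Runs.push _ _ _)) this).conv ?_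
      (by simp only [List.length_cons]; omega)
    funext i
    by_cases hk' : i = k'
    · subst hk'
      simp [hjk'.symm, hkk'.symm]
    · by_cases hk : i = k
      · subst hk
        simp [hjk.symm, hkk']
      · by_cases hj : i = j
        · subst hj
          simp [hjk, hjk']
        · simp [hk, hj, hk']

end Runs

end StackProg

namespace UnderMatch

open Computability (Γ')
open UnderMatchInput (writeBlock)

/-! ### The memory of the decision procedure -/

/-- What the decision procedure stores about a state. -/
structure Cell where
  /-- the state is labeled by the precondition of the refined goal -/
  inPre : Bool
  /-- the state is labeled by the postcondition of the refined goal -/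
  inPost : Bool
  /-- the state is reached from a start outside the precondition of the refined goal -/
  fromBad : Bool
  /-- the state is reached from some start -/
  fromAny : Bool
  /-- a violation of the inclusion ends in the state -/
  viol : Bool
  deriving DecidableEq, Fintype

/-- The stacks: input, output, the adjacency matrix and the label rows with a buffer for both, the
cells with a buffer, a copy of the cells with a buffer, a counter. -/
inductive Stk
  | inp | out | mat | lab | buf | x | xb | y | yb | ctr
  deriving DecidableEq

instance : Fintype Stk :=
  ⟨{.inp, .out, .mat, .lab, .buf, .x, .xb, .y, .yb, .ctr}, fun k => by cases k <;> decide⟩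

/-- The alphabets of the stacks; the rows of matrices are terminated by `none`. -/
@[reducible] def Alph : Stk → Type
  | .inp => Γ'
  | .out => Bool
  | .mat | .lab | .buf => Option Bool
  | .x | .xb | .y | .yb | .ctr => Cell

instance : ∀ k, Fintype (Alph k)
  | .inp => inferInstanceAs (Fintype Γ')
  | .out => inferInstanceAs (Fintype Bool)
  | .mat | .lab | .buf => inferInstanceAs (Fintype (Option Bool))
  | .x | .xb | .y | .yb | .ctr => inferInstanceAs (Fintype Cell)

/-- The contents of the stacks. -/
structure Mem where
  /-- input -/
  inp : List Γ' := []
  /-- output -/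
  out : List Bool := []
  /-- adjacency matrix -/
  mat : List (Option Bool) := []
  /-- label rows -/
  lab : List (Option Bool) := []
  /-- buffer for `mat` and `lab` -/
  buf : List (Option Bool) := []
  /-- cells -/
  x : List Cell := []
  /-- buffer for `x` -/
  xb : List Cell := []
  /-- copy of the cells -/
  y : List Cell := []
  /-- buffer for `y` -/
  yb : List Cell := []
  /-- counter -/
  ctr : List Cell := []

namespace Mem

/-- The contents of the stacks as a function. -/
def store (s : Mem) : StackProg.Store Alph
  | .inp => s.inp
  | .out => s.out
  | .mat => s.mat
  | .lab => s.lab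
  | .buf => s.buf
  | .x => s.x
  | .xb => s.xb
  | .y => s.y
  | .yb => s.yb
  | .ctr => s.ctr

/-- Replace the contents of a stack. -/
def set (s : Mem) : ∀ k, List (Alph k) → Mem
  | .inp, v => { s with inp := v }
  | .out, v => { s with out := v }
  | .mat, v => { s with mat := v }
  | .lab, v => { s with lab := v }
  | .buf, v => { s with buf := v }
  | .x, v => { s with x := v }
  | .xb, v => { s with xb := v }
  | .y, v => { s with y := v }
  | .yb, v => { s with yb := v }
  | .ctr, v => { s with ctr := v }

/-- This replaces dependent function updates by record updates, so that `simp` can evaluate the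
memory after a sequence of operations. -/
theorem store_set (s : Mem) (k : Stk) (v : List (Alph k)) :
    Function.update s.store k v = (s.set k v).store := by
  funext j
  by_cases h : j = k
  · subst h
    rw [Function.update_self]
    cases j <;> rfl
  · rw [Function.update_of_ne h]
    cases j <;> cases k <;> first | rfl | exact absurd rfl h

end Mem

/-- Started in the memory `s`, the program ends in the memory `s'` after at most `T` steps. -/
def Runs (p : StackProg Alph) (s s' : Mem) (T : ℕ) : Prop :=
  StackProg.Runs p s.store s'.store T

namespace Runs

variable {s s' s₁ s₂ s₃ : Mem} {p q : StackProg Alph} {T T' T₁ T₂ : ℕ}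

theorem conv {s'' : Mem} (h : Runs p s s' T) (hs : s' = s'') (hT : T ≤ T') : Runs p s s'' T' :=
  hs ▸ StackProg.Runs.mono h hT

theorem skip (s : Mem) : Runs .skip s s 1 := StackProg.Runs.skip _

theorem push (s : Mem) (k : Stk) (a : Alph k) : Runs (.push k a) s (s.set k (a :: s.store k)) 1 := by
  have := StackProg.Runs.push s.store k a
  rwa [Mem.store_set] at this

theorem seq (hp : Runs p s₁ s₂ T₁) (hq : Runs q s₂ s₃ T₂) : Runs (.seq p q) s₁ s₃ (T₁ + T₂) :=
  StackProg.Runs.seq hp hq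

section loop

variable {k : Stk} {body : Option (Alph k) → StackProg Alph} {cont : Option (Alph k) → Bool}
  {a : Alph k} {l : List (Alph k)}

theorem loop_nil (hs : s.store k = []) (hc : cont none = false) (h : Runs (body none) s s' T) :
    Runs (.loop k body cont) s s' (T + 1) :=
  StackProg.Runs.loop_nil hs hc h

theorem loop_last (hs : s.store k = a :: l) (hc : cont (some a) = false)
    (h : Runs (body (some a)) (s.set k l) s' T) : Runs (.loop k body cont) s s' (T + 1) :=
  StackProg.Runs.loop_last hs hc (by rw [Mem.store_set]; exact h)

theorem loop_cons (hs : s.store k = a :: l) (hc : cont (some a) = true)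
    (h : Runs (body (some a)) (s.set k l) s₂ T) (h' : Runs (.loop k body cont) s₂ s' T') :
    Runs (.loop k body cont) s s' (T + 1 + T') :=
  StackProg.Runs.loop_cons hs hc (by rw [Mem.store_set]; exact h) h'

end loop

theorem clear (s : Mem) (k : Stk) :
    Runs (.clear k) s (s.set k []) (2 * (s.store k).length + 2) := by
  have := StackProg.Runs.clear s.store k
  rwa [Mem.store_set] at this

theorem move {j k : Stk} (hjk : j ≠ k) (f : Alph j → Alph k) (s : Mem) :
    Runs (.move j k f) s ((s.set j []).set k (((s.store j).map f).reverse ++ s.store k))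
      (2 * (s.store j).length + 2) := by
  have := StackProg.Runs.move hjk f s.store
  rwa [Mem.store_set, Mem.store_set] at this

theorem moveTwo {j k k' : Stk} (hjk : j ≠ k) (hjk' : j ≠ k') (hkk' : k ≠ k') (f : Alph j → Alph k)
    (f' : Alph j → Alph k') (s : Mem) :
    Runs (.moveTwo j k k' f f') s
      (((s.set j []).set k (((s.store j).map f).reverse ++ s.store k)).set k'
        (((s.store j).map f').reverse ++ s.store k'))
      (3 * (s.store j).length + 2) := by
  have := StackProg.Runs.moveTwo hjk hjk' hkk' f f' s.store
  rwa [Mem.store_set, Mem.store_set, Mem.store_set] at this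

end Runs

/-! ### Reading the input -/

/-- A row of a matrix, as it is stored. -/
def rowSyms (r : List Bool) : List (Option Bool) := r.map some ++ [none]

/-- A matrix, as it is stored. -/
def flat (rows : List (List Bool)) : List (Option Bool) := rows.flatMap rowSyms

@[simp] theorem length_rowSyms (r : List Bool) : (rowSyms r).length = r.length + 1 := by
  simp [rowSyms]

@[simp] theorem flat_nil : flat [] = [] := rfl

@[simp] theorem flat_cons (r : List Bool) (rows : List (List Bool)) :
    flat (r :: rows) = rowSyms r ++ flat rows := rfl

theorem flat_append (A B : List (List Bool)) : flat (A ++ B) = flat A ++ flat B := by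
  simp [flat]

/-- Every row contributes at least its terminator. -/
theorem length_le_length_flat (rows : List (List Bool)) : rows.length ≤ (flat rows).length := by
  induction rows with
  | nil => simp
  | cons r rows ih => simp; omega

theorem length_writeBlock (rows : List (List Bool)) :
    (writeBlock rows).length = (flat rows).length + 1 := by
  induction rows with
  | nil => rfl
  | cons r rows ih => simp [writeBlock, ih]; omega

/-- The cell of a state about which nothing is known. -/
def Cell.empty : Cell := ⟨false, false, false, false, false⟩

/-- Read a matrix from the input into the buffer, and push a cell per row on the counter. -/
def readBlock : StackProg Alph :=
  .loop .inp
    (fun o => match o with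
      | some (.bit b) => .push .buf (some b)
      | some .comma => .seq (.push .buf none) (.push .ctr Cell.empty)
      | _ => .skip)
    (fun o => match o with
      | some (.bit _) => true
      | some .comma => true
      | _ => false)

/-- A bit costs two steps and a comma three, so three steps per stored symbol suffice; the closing
`ket` accounts for the last two. -/
theorem runs_readBlock (rows : List (List Bool)) (rest : List Γ') (s : Mem)
    (hs : s.inp = writeBlock rows ++ rest) :
    Runs readBlock s { s with
      inp := rest
      buf := (flat rows).reverse ++ s.buf
      ctr := List.replicate rows.length Cell.empty ++ s.ctr } (3 * (flat rows).length + 2) := by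
  induction rows generalizing s with
  | nil => exact Runs.loop_last (k := .inp) (a := Γ'.ket) hs rfl (Runs.skip _)
  | cons r rows ih =>
    -- The inner induction consumes the current row bit by bit; at its comma the outer hypothesis
    -- takes over.
    induction r generalizing s with
    | nil =>
      refine (Runs.loop_cons (k := .inp) (a := Γ'.comma) hs rfl (.seq (Runs.push _ .buf none)
        (Runs.push _ .ctr Cell.empty)) (ih _ (by rfl))).conv ?_ ?_
      · simp [Mem.set, Mem.store, rowSyms, List.replicate_succ']
      · simp; omega
    | cons b r ihr =>
      refine (Runs.loop_cons (k := .inp) (a := Γ'.bit b) hs rfl (Runs.push _ .buf (some b))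
        (ihr _ (by rfl))).conv ?_ ?_
      · simp [Mem.set, Mem.store, rowSyms]
      · simp; omega

/-! ### Selecting a row of the labeling -/

/-- Move a label row to the buffer. -/
def skipRow : StackProg Alph :=
  .loop .lab (fun o => o.elim .skip fun a => .push .buf a) (fun o => (o.getD none).isSome)

theorem runs_skipRow (r : List Bool) (rest : List (Option Bool)) (s : Mem)
    (hs : s.lab = rowSyms r ++ rest) :
    Runs skipRow s { s with lab := rest, buf := (rowSyms r).reverse ++ s.buf }
      (2 * r.length + 2) := by
  induction r generalizing s with
  | nil => exact Runs.loop_last (k := .lab) (a := none) hs rfl (Runs.push _ .buf none)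
  | cons b r ih =>
    refine (Runs.loop_cons (k := .lab) (a := some b) hs rfl (Runs.push _ .buf (some b)) (ih _ (by rfl))).conv ?_ ?_
    · simp [Mem.set, Mem.store, rowSyms]
    · simp; omega

/-- Read a number in unary from the input, and move as many label rows to the buffer. -/
def skipRows : StackProg Alph :=
  .loop .inp
    (fun o => match o with
      | some (.bit _) => skipRow
      | _ => .skip)
    (fun o => match o with
      | some (.bit _) => true
      | _ => false)

/-- Each unary digit on the input skips one label row, so the number read equals the number of rows
before the selected one. -/
theorem runs_skipRows (A B : List (List Bool)) (rest : List Γ') (s : Mem)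
    (hs : s.inp = (List.replicate A.length true).map Γ'.bit ++ Γ'.comma :: rest)
    (hl : s.lab = flat (A ++ B)) :
    Runs skipRows s { s with inp := rest, lab := flat B, buf := (flat A).reverse ++ s.buf }
      (3 * (flat A).length + 2) := by
  induction A generalizing s with
  | nil =>
    refine (Runs.loop_last (k := .inp) (a := Γ'.comma) hs rfl (Runs.skip _)).conv ?_ (Nat.le_add_left 2 _)
    simp_all [Mem.set]
  | cons r A ih =>
    refine (Runs.loop_cons (k := .inp) (a := Γ'.bit true) hs rfl
      (runs_skipRow r (flat (A ++ B)) _ (by exact hl)) (ih _ (by rfl) (by rfl))).conv ?_ ?_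
    · simp [Mem.set]
    · simp; omega

/-- Move a label row to the buffer and combine the cells with it. -/
def applyRow (f : Cell → Bool → Cell) : StackProg Alph :=
  .loop .lab
    (fun o => match o with
      | some (some b) => .seq (.push .buf (some b))
          (.loop .x (fun o => o.elim .skip fun c => .push .xb (f c b)) fun _ => false)
      | some none => .push .buf none
      | none => .skip)
    (fun o => (o.getD none).isSome)

/-- A loop whose `cont` is constantly `false` is a single pop with a case distinction. Used inside
the loop over the row, it pairs the `i`-th cell with the `i`-th bit. -/
theorem runs_applyRow (f : Cell → Bool → Cell) (r : List Bool) (X : List Cell)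
    (rest : List (Option Bool)) (s : Mem) (hs : s.lab = rowSyms r ++ rest) (hx : s.x = X)
    (hr : X.length = r.length) :
    Runs (applyRow f) s { s with
      lab := rest, buf := (rowSyms r).reverse ++ s.buf
      x := [], xb := (List.zipWith f X r).reverse ++ s.xb } (4 * r.length + 2) := by
  induction r generalizing s X with
  | nil =>
    obtain rfl := List.length_eq_zero_iff.mp hr
    refine (Runs.loop_last (k := .lab) (a := none) hs rfl (Runs.push _ .buf none)).conv ?_ (Nat.le_add_left 2 _)
    simp [Mem.set, hx, Mem.store, rowSyms]
  | cons b r ih =>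
    obtain _ | ⟨c, X⟩ := X
    · simp at hr
    refine (Runs.loop_cons (k := .lab) (a := some b) hs rfl (.seq (Runs.push _ .buf (some b))
      (Runs.loop_last (k := .x) (a := c) (by exact hx) rfl (Runs.push _ .xb (f c b))))
      (ih X _ (by rfl) (by rfl) (by simpa using hr))).conv ?_ ?_
    · simp [Mem.set, Mem.store, rowSyms]
    · simp; omega

/-- Read a number in unary from the input, and combine the cells with the label row that has this
number. -/
def select (f : Cell → Bool → Cell) : StackProg Alph :=
  .seq skipRows (.seq (applyRow f) (.seq (.move .buf .lab id) (.move .xb .x id)))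

theorem runs_select (f : Cell → Bool → Cell) (L : List (List Bool)) (p : ℕ) (hp : p < L.length)
    (rest : List Γ') (s : Mem)
    (hs : s.inp = (List.replicate p true).map Γ'.bit ++ Γ'.comma :: rest)
    (hl : s.lab = flat L) (hx : s.x.length = L[p].length) (hbuf : s.buf = []) (hxb : s.xb = []) :
    Runs (select f) s { s with inp := rest, x := List.zipWith f s.x L[p] }
      (14 * (flat L).length + 10) := by
  -- The rows up to the selected one end up reversed in the buffer, above the untouched rest; moving
  -- them back restores the labeling for later selections.
  have hL : L = L.take p ++ L[p] :: L.drop (p + 1) := by simp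
  have hlen : (flat L).length = (flat (L.take p)).length + (L[p].length + 1) +
      (flat (L.drop (p + 1))).length := by
    conv_lhs => rw [hL, flat_append, flat_cons]
    simp; omega
  have hA : (L.take p).length = p := by simp; omega
  have h1 := runs_skipRows (L.take p) (L[p] :: L.drop (p + 1)) rest s
    (by rw [hs, hA]) (by rw [← hL, hl])
  refine (h1.seq ((runs_applyRow f L[p] s.x (flat (L.drop (p + 1))) _ (by rfl) (by rfl) hx).seq ((Runs.move (j := .buf) (k := .lab) (by decide) id _).seq
    (Runs.move (j := .xb) (k := .x) (by decide) id _)))).conv ?_ ?_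
  · have : flat (L.take p) ++ (rowSyms L[p] ++ flat (L.drop (p + 1))) = s.lab := by
      rw [hl, ← flat_cons, ← flat_append, ← hL]
    simp [Mem.set, Mem.store, hbuf, hxb, this]
  · simp [Mem.set, Mem.store, hbuf, hxb, hx]
    omega

/-! ### Reachability -/

/-- Note in the cell `d` that there is a transition from the state of the cell `c`, if `b`. -/
def Cell.update (c d : Cell) (b : Bool) : Cell :=
  { d with fromBad := d.fromBad || (b && c.fromBad), fromAny := d.fromAny || (b && c.fromAny) }

/-- For each transition, update the cell in the copy. -/
def sweep : StackProg Alph :=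
  .loop .mat
    (fun o => match o with
      | some (some b) => .seq (.push .buf (some b))
          (.loop .x (fun o => o.elim .skip fun c => .seq (.push .x c)
            (.loop .y (fun o => o.elim .skip fun d => .push .yb (c.update d b)) fun _ => false))
            fun _ => false)
      | some none => .seq (.push .buf none)
          (.seq (.loop .x (fun _ => .skip) fun _ => false) (.move .yb .y id))
      | none => .skip)
    Option.isSome

/-- Update the cells `Y` by the transitions from the states of the cells `X`. -/
def sweepCells (rows : List (List Bool)) (X Y : List Cell) : List Cell :=
  (X.zip rows).foldl (fun Y cr => List.zipWith cr.1.update Y cr.2) Y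

/-- `sweep` is one loop over all matrix symbols, so the treatment of a single row is not a complete
run. It is stated with the run `h` on the remaining rows as continuation. During the row `c` stays
on top of `x`, and `yb` holds the cells already updated; each bit costs six steps, plus two to move
its cell back. -/
theorem runs_sweep_row (c : Cell) (X : List Cell) (r : List Bool) (Y : List Cell)
    (rest : List (Option Bool)) (s s' : Mem) (T : ℕ) (hs : s.mat = rowSyms r ++ rest)
    (hx : s.x = c :: X) (hy : s.y = Y) (hr : Y.length = r.length)
    (h : Runs sweep { s with
      mat := rest, buf := (rowSyms r).reverse ++ s.buf, x := X
      y := s.yb.reverse ++ List.zipWith c.update Y r, yb := [] } s' T) :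
    Runs sweep s s' (8 * r.length + 2 * s.yb.length + 7 + T) := by
  induction r generalizing s Y with
  | nil =>
    obtain rfl := List.length_eq_zero_iff.mp hr
    refine (Runs.loop_cons (k := .mat) (a := none) hs rfl (.seq (Runs.push _ .buf none)
      (.seq (Runs.loop_last (k := .x) (a := c) (by exact hx) rfl (Runs.skip _))
      (Runs.move (j := .yb) (k := .y) (by decide) id _))) (T' := T) ?_).conv rfl ?_
    · change Runs sweep _ _ _
      simpa [Mem.set, Mem.store, hy, rowSyms] using h
    · simp [Mem.set, Mem.store]; omega
  | cons b r ih =>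
    obtain _ | ⟨d, Y⟩ := Y
    · simp at hr
    refine (Runs.loop_cons (k := .mat) (a := some b) hs rfl (.seq (Runs.push _ .buf (some b))
      (Runs.loop_last (k := .x) (a := c) (by exact hx) rfl (.seq (Runs.push _ .x c)
      (Runs.loop_last (k := .y) (a := d) (by exact hy) rfl (Runs.push _ .yb (c.update d b))))))
      (ih Y _ (by rfl) (by rfl) (by rfl) (by simpa using hr) ?_)).conv rfl ?_
    · simpa [Mem.set, Mem.store, rowSyms, hx] using h
    · simp [Mem.set, Mem.store]; omega

/-- Marks are read from the cells `X` and written to the separate list `y`, so all rows use the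
marks from before the sweep. -/
theorem runs_sweep (rows : List (List Bool)) (X : List Cell) (s : Mem)
    (hs : s.mat = flat rows) (hx : s.x = X) (hX : X.length = rows.length)
    (hr : ∀ r ∈ rows, s.y.length = r.length) (hyb : s.yb = []) :
    Runs sweep s { s with
      mat := [], buf := (flat rows).reverse ++ s.buf, x := [], y := sweepCells rows X s.y }
      (8 * (flat rows).length + 2) := by
  induction rows generalizing s X with
  | nil =>
    obtain rfl := List.length_eq_zero_iff.mp hX
    refine (Runs.loop_nil (k := .mat) hs rfl (Runs.skip _)).conv ?_ (Nat.le_add_left 2 _)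
    cases s
    simp_all [sweepCells]
  | cons r rows ih =>
    obtain _ | ⟨c, X⟩ := X
    · simp at hX
    have hrl := hr r (by simp)
    refine (runs_sweep_row c X r s.y (flat rows) s _ _ hs (by exact hx) rfl hrl
      (ih X _ (by rfl) (by rfl) (by simpa using hX) ?_ (by rfl))).conv ?_ ?_
    · intro r' h'
      simp [hyb, ← hrl, ← hr r' (by simp [h'])]
    · simp [hyb, sweepCells]
    · simp [hyb]; omega

/-- Copy the cells. -/
def copyCells : StackProg Alph :=
  .seq (.moveTwo .x .xb .yb id id) (.seq (.move .xb .x id) (.move .yb .y id))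

theorem runs_copyCells (s : Mem) (hxb : s.xb = []) (hy : s.y = []) (hyb : s.yb = []) :
    Runs copyCells s { s with y := s.x } (7 * s.x.length + 6) := by
  refine ((Runs.moveTwo (j := .x) (k := .xb) (k' := .yb) (by decide) (by decide) (by decide)
    id id s).seq ((Runs.move (j := .xb) (k := .x) (by decide) id _).seq
    (Runs.move (j := .yb) (k := .y) (by decide) id _))).conv ?_ ?_
  · simp [Mem.set, Mem.store, hxb, hy, hyb]
  · simp [Mem.set, Mem.store, hxb, hyb]
    omega

/-- Mark the successors of the marked states. -/
def step : StackProg Alph :=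
  .seq copyCells (.seq sweep
    (.seq (.move .buf .mat id) (.seq (.move .y .yb id) (.move .yb .x id))))

theorem length_sweepCells {rows : List (List Bool)} {X Y : List Cell}
    (hr : ∀ r ∈ rows, Y.length = r.length) : (sweepCells rows X Y).length = Y.length := by
  induction rows generalizing X Y with
  | nil => simp [sweepCells]
  | cons r rows ih =>
    cases X with
    | nil => simp [sweepCells]
    | cons c X =>
      have h1 := hr r (by simp)
      have h2 : (List.zipWith c.update Y r).length = Y.length := by simp [h1]
      refine (ih fun r' h' => ?_).trans h2
      rw [h2, hr r' (by simp [h'])]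

theorem runs_step (rows : List (List Bool)) (s : Mem) (hs : s.mat = flat rows)
    (hX : s.x.length = rows.length) (hr : ∀ r ∈ rows, s.x.length = r.length)
    (hbuf : s.buf = []) (hxb : s.xb = []) (hy : s.y = []) (hyb : s.yb = []) :
    Runs step s { s with x := sweepCells rows s.x s.x } (21 * (flat rows).length + 14) := by
  refine ((runs_copyCells s hxb hy hyb).seq ((runs_sweep rows s.x _ (by exact hs) (by rfl) hX
    (by exact hr) (by exact hyb)).seq
    ((Runs.move (j := .buf) (k := .mat) (by decide) id _).seq
    ((Runs.move (j := .y) (k := .yb) (by decide) id _).seq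
    (Runs.move (j := .yb) (k := .x) (by decide) id _))))).conv ?_ ?_
  · simp [Mem.set, Mem.store, hbuf, hy, hyb, hs]
  · have := length_le_length_flat rows
    simp [Mem.set, Mem.store, hbuf, hyb, length_sweepCells hr, hX]
    omega

/-- Perform a step for each symbol of the counter. -/
def steps : StackProg Alph :=
  .loop .ctr (fun o => o.elim .skip fun _ => step) Option.isSome

theorem runs_steps (rows : List (List Bool)) (ctr : List Cell) (s : Mem) (hc : s.ctr = ctr)
    (hs : s.mat = flat rows)
    (hX : s.x.length = rows.length) (hr : ∀ r ∈ rows, s.x.length = r.length)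
    (hbuf : s.buf = []) (hxb : s.xb = []) (hy : s.y = []) (hyb : s.yb = []) :
    Runs steps s { s with x := (fun X => sweepCells rows X X)^[ctr.length] s.x, ctr := [] }
      (ctr.length * (21 * (flat rows).length + 15) + 2) := by
  induction ctr generalizing s with
  | nil =>
    refine (Runs.loop_nil (k := .ctr) hc rfl (Runs.skip _)).conv ?_ (by simp)
    cases s
    simp_all
  | cons c ctr ih =>
    refine (Runs.loop_cons (k := .ctr) (a := c) hc rfl
      (runs_step rows _ (by exact hs) (by exact hX) (by exact hr) (by exact hbuf) (by exact hxb)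
        (by exact hy) (by exact hyb))
      (ih _ (by rfl) (by exact hs) ?_ ?_ (by exact hbuf) (by exact hxb)
        (by exact hy) (by exact hyb))).conv ?_ ?_
    · exact (length_sweepCells hr).trans hX
    · intro r h
      exact (length_sweepCells hr).trans (hr r h)
    · simp [Mem.set]
    · rw [List.length_cons, Nat.add_one_mul ctr.length]
      omega

/-- Mark the states that are reachable from the marked states. -/
def reach : StackProg Alph :=
  .seq (.moveTwo .x .xb .ctr id id) (.seq (.move .xb .x id) steps)

/-- Only the length of the copy of the cells on the counter matters: it makes the number of steps
equal to the number of states. -/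
theorem runs_reach (rows : List (List Bool)) (s : Mem) (hc : s.ctr = [])
    (hs : s.mat = flat rows)
    (hX : s.x.length = rows.length) (hr : ∀ r ∈ rows, s.x.length = r.length)
    (hbuf : s.buf = []) (hxb : s.xb = []) (hy : s.y = []) (hyb : s.yb = []) :
    Runs reach s { s with x := (fun X => sweepCells rows X X)^[rows.length] s.x }
      (rows.length * (21 * (flat rows).length + 20) + 6) := by
  refine ((Runs.moveTwo (j := .x) (k := .xb) (k' := .ctr) (by decide) (by decide) (by decide)
    id id s).seq ((Runs.move (j := .xb) (k := .x) (by decide) id _).seq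
    (runs_steps rows s.x.reverse _ ?_ (by exact hs) ?_ ?_ (by exact hbuf) (by rfl)
      (by exact hy) (by exact hyb)))).conv ?_ ?_
  · simp [Mem.set, Mem.store, hc]
  · simpa [Mem.set, Mem.store, hxb] using hX
  · simpa [Mem.set, Mem.store, hxb] using hr
  · simp [Mem.set, Mem.store, hxb, hX, hc]
  · simp [Mem.set, Mem.store, hxb, hX, Nat.mul_add]
    omega

end UnderMatch

namespace UnderMatch

open Computability (Γ')
open UnderMatchInput (writeBlock)

/-! ### The decision procedure -/

section

variable {n m : ℕ} (adj : Fin n → Fin n → Bool) (lab : Fin m → Fin n → Bool)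

/-- A Boolean matrix as a list of rows. -/
def rowsOf {k : ℕ} (M : Fin k → Fin n → Bool) : List (List Bool) :=
  List.ofFn fun i => List.ofFn (M i)

@[simp] theorem length_rowsOf {k : ℕ} (M : Fin k → Fin n → Bool) : (rowsOf M).length = k := by
  simp [rowsOf]

theorem length_of_mem_rowsOf {k : ℕ} {M : Fin k → Fin n → Bool} {r : List Bool}
    (h : r ∈ rowsOf M) : r.length = n := by
  simp only [rowsOf, List.mem_ofFn] at h
  obtain ⟨i, rfl⟩ := h
  simp

theorem zipWith_ofFn {α β γ : Type*} (f : α → β → γ) (ξ : Fin n → α) (r : Fin n → β) :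
    List.zipWith f (List.ofFn ξ) (List.ofFn r) = List.ofFn fun s => f (ξ s) (r s) := by
  apply List.ext_getElem <;> simp

/-- The memory between two operations on the cells `ξ`. -/
def ready (inp : List Γ') (ξ : Fin n → Cell) : Mem where
  inp := inp
  mat := flat (rowsOf adj)
  lab := flat (rowsOf lab)
  x := List.ofFn ξ

/-- The cells after a step. -/
def stepCells (ξ : Fin n → Cell) (t : Fin n) : Cell :=
  { ξ t with
    fromBad := (ξ t).fromBad || decide (∃ s, adj s t ∧ (ξ s).fromBad)
    fromAny := (ξ t).fromAny || decide (∃ s, adj s t ∧ (ξ s).fromAny) }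

theorem sweepCells_rowsOf (ξ : Fin n → Cell) :
    sweepCells (rowsOf adj) (List.ofFn ξ) (List.ofFn ξ) = List.ofFn (stepCells adj ξ) := by
  -- The sweep distributes marks source by source, whereas `stepCells` asks for a marked predecessor
  -- of each target. They are compared for a partial list `l` of sources and arbitrary current cells
  -- `η`, with the source marks `ξ` fixed.
  have key : ∀ (l : List (Fin n)) (η : Fin n → Cell),
      (l.map fun s => (ξ s, List.ofFn (adj s))).foldl
        (fun Y cr => List.zipWith cr.1.update Y cr.2) (List.ofFn η) =
      List.ofFn fun t => { η t with
        fromBad := (η t).fromBad || l.any fun s => adj s t && (ξ s).fromBad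
        fromAny := (η t).fromAny || l.any fun s => adj s t && (ξ s).fromAny } := by
    intro l
    induction l with
    | nil => simp
    | cons s l ih =>
      intro η
      rw [List.map_cons, List.foldl_cons, zipWith_ofFn, ih]
      simp [Cell.update, Bool.or_assoc]
  have hz : (List.ofFn ξ).zip (rowsOf adj) =
      (List.finRange n).map fun s => (ξ s, List.ofFn (adj s)) := by
    rw [List.zip, rowsOf, zipWith_ofFn, List.ofFn_eq_map]
  rw [sweepCells, hz, key]
  congr 1
  funext t
  simp only [stepCells, Cell.mk.injEq, true_and, and_true]
  constructor <;> congr 1 <;> rw [Bool.eq_iff_iff] <;> simp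

theorem runs_select_ready (f : Cell → Bool → Cell) (p : Fin m) (rest : List Γ') (ξ : Fin n → Cell) :
    Runs (select f)
      (ready adj lab ((List.replicate p.val true).map Γ'.bit ++ Γ'.comma :: rest) ξ)
      (ready adj lab rest fun s => f (ξ s) (lab p s)) (14 * (flat (rowsOf lab)).length + 10) := by
  have hp : p.val < (rowsOf lab).length := by simp
  have hrow : (rowsOf lab)[p.val] = List.ofFn (lab p) := by simp [rowsOf]
  refine (runs_select f (rowsOf lab) p hp rest _ rfl rfl ?_ rfl rfl).conv ?_ le_rfl
  · simp [hrow, ready]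
  · simp [hrow, ready, zipWith_ofFn]

theorem runs_reach_ready (inp : List Γ') (ξ : Fin n → Cell) :
    Runs reach (ready adj lab inp ξ) (ready adj lab inp ((stepCells adj)^[n] ξ))
      (n * (21 * (flat (rowsOf adj)).length + 20) + 6) := by
  refine (runs_reach (rowsOf adj) _ rfl rfl ?_ ?_ rfl rfl rfl rfl).conv ?_ ?_
  · simp [ready]
  · intro r hr
    simp [ready, length_of_mem_rowsOf hr]
  · have : ∀ k, (fun X => sweepCells (rowsOf adj) X X)^[k] (List.ofFn ξ) =
        List.ofFn ((stepCells adj)^[k] ξ) := by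
      intro k
      induction k with
      | zero => rfl
      | succ k ih =>
        rw [Function.iterate_succ_apply', ih, Function.iterate_succ_apply', sweepCells_rowsOf]
    simp [ready, this]
  · simp

/-- Keep the marks of a cell if `b`. -/
def Cell.restrict (c : Cell) (b : Bool) : Cell :=
  { c with fromBad := c.fromBad && b, fromAny := c.fromAny && b }

/-- Process a goal: go from the precondition to the postcondition, and apply `op` to the cells. -/
def goalProg (op : Cell → Cell) : StackProg Alph :=
  .seq (select Cell.restrict) (.seq reach (select fun c b => op (c.restrict b)))

/-- The cells after a goal was processed. -/
def goalCells (op : Cell → Cell) (ξ : Fin n → Cell) (g : Goal (Fin m)) (s : Fin n) : Cell :=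
  op (Cell.restrict ((stepCells adj)^[n] (fun s => (ξ s).restrict (lab g.pre s)) s)
    (lab g.post s))

/-- The rows that encode a list of goals. -/
def goalRows (gs : List (Goal (Fin m))) : List (List Bool) :=
  gs.flatMap fun g => [List.replicate g.pre.val true, List.replicate g.post.val true]

/-- The time to process a goal. -/
def goalTime (N : ℕ) : ℕ := N * (21 * N + 20) + 28 * N + 26

variable {adj lab} {N : ℕ}

theorem runs_goalProg (hn : n ≤ N) (hadj : (flat (rowsOf adj)).length ≤ N)
    (hlab : (flat (rowsOf lab)).length ≤ N) (op : Cell → Cell) (g : Goal (Fin m))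
    (rows : List (List Bool)) (ξ : Fin n → Cell) :
    Runs (goalProg op)
      (ready adj lab (writeBlock
        (List.replicate g.pre.val true :: List.replicate g.post.val true :: rows)) ξ)
      (ready adj lab (writeBlock rows) (goalCells adj lab op ξ g)) (goalTime N) := by
  refine ((runs_select_ready adj lab _ g.pre _ ξ).seq ((runs_reach_ready adj lab _ _).seq
    (runs_select_ready adj lab _ g.post _ _))).conv rfl ?_
  have : n * (21 * (flat (rowsOf adj)).length + 20) ≤ N * (21 * N + 20) :=
    Nat.mul_le_mul hn (by omega)
  unfold goalTime
  omega

/-- Process all goals. -/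
def goalsProg (op : Cell → Cell) : StackProg Alph :=
  .loop .inp
    (fun o => match o with
      | some .ket => .skip
      | some a => .seq (.push .inp a) (goalProg op)
      | none => .skip)
    (fun o => match o with
      | some .ket => false
      | some _ => true
      | none => false)

/-- The loop looks one symbol ahead: `ket` ends the list, and any other symbol belongs to the next
goal and is pushed back. Per goal, the two extra steps are this pop and push. -/
theorem runs_goalsProg (hn : n ≤ N) (hadj : (flat (rowsOf adj)).length ≤ N)
    (hlab : (flat (rowsOf lab)).length ≤ N) (op : Cell → Cell) (gs : List (Goal (Fin m)))
    (ξ : Fin n → Cell) :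
    Runs (goalsProg op) (ready adj lab (writeBlock (goalRows gs)) ξ)
      (ready adj lab [] (gs.foldl (goalCells adj lab op) ξ))
      (gs.length * (goalTime N + 2) + 2) := by
  induction gs generalizing ξ with
  | nil =>
    refine (Runs.loop_last (k := .inp) (a := Γ'.ket) (by rfl) rfl (Runs.skip _)).conv ?_ (by simp)
    simp [ready, Mem.set]
  | cons g gs ih =>
    have hg := runs_goalProg hn hadj hlab op g (goalRows gs) ξ
    have key : ∀ a l, a ≠ Γ'.ket →
        writeBlock (List.replicate g.pre.val true :: List.replicate g.post.val true ::
          goalRows gs) = a :: l →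
        Runs (goalsProg op) (ready adj lab (writeBlock (goalRows (g :: gs))) ξ)
          (ready adj lab [] ((g :: gs).foldl (goalCells adj lab op) ξ))
          ((g :: gs).length * (goalTime N + 2) + 2) := by
      intro a l ha hl
      rw [hl] at hg
      refine (Runs.loop_cons (k := .inp) (a := a) (by exact hl) ?_ (T := 1 + goalTime N) ?_
        (ih _)).conv rfl ?_
      · cases a <;> first | rfl | exact absurd rfl ha
      · have h := (Runs.push ((ready adj lab (writeBlock (goalRows (g :: gs))) ξ).set .inp l)
          .inp a).seq hg
        cases a <;> first | exact h | exact absurd rfl ha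
      · rw [List.length_cons, Nat.add_one_mul gs.length]
        omega
    -- The code of a goal starts with a comma if its precondition has number zero, and with a bit
    -- otherwise; in neither case with `ket`.
    cases h : g.pre.val with
    | zero => exact key Γ'.comma _ (by simp) (by rw [h]; rfl)
    | succ k => exact key (Γ'.bit true) _ (by simp) (by rw [h]; rfl)

end

/-- Answer whether no cell is marked as a violation, and empty the stack of cells. -/
def answer : StackProg Alph :=
  .loop .x
    (fun o => o.elim .skip fun c =>
      .loop .out (fun o => o.elim .skip fun b => .push .out (b && !c.viol)) fun _ => false)
    Option.isSome

theorem runs_answer (X : List Cell) (s : Mem) (b : Bool) (hx : s.x = X) (hb : s.out = [b]) :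
    Runs answer s { s with x := [], out := [b && X.all fun c => !c.viol] }
      (3 * X.length + 2) := by
  induction X generalizing s b with
  | nil =>
    refine (Runs.loop_nil (k := .x) hx rfl (Runs.skip _)).conv ?_ (by simp)
    cases s
    simp_all
  | cons c X ih =>
    refine (Runs.loop_cons (k := .x) (a := c) hx rfl (Runs.loop_last (k := .out) (a := b)
      (by exact hb) rfl (Runs.push _ .out (b && !c.viol)))
      (ih _ (b && !c.viol) (by rfl) (by rfl))).conv ?_ ?_
    · simp [Mem.set, Bool.and_assoc]
    · simp only [List.length_cons]
      omega

/-- Note in a cell whether the state is labeled by the precondition of the refined goal. -/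
def Cell.setPre (c : Cell) (b : Bool) : Cell :=
  { c with inPre := b, fromBad := !b, fromAny := true }

/-- Note in a cell whether the state is labeled by the postcondition of the refined goal. -/
def Cell.setPost (c : Cell) (b : Bool) : Cell :=
  { c with inPost := b }

/-- Read the adjacency matrix and the labeling, and create a cell for each state. -/
def load : StackProg Alph :=
  .seq readBlock (.seq (.move .buf .mat id) (.seq (.move .ctr .x id)
    (.seq readBlock (.seq (.move .buf .lab id) (.clear .ctr)))))

/-- Reading the square adjacency matrix leaves one counter cell per state, which become the initial
cells. Reading the labeling leaves one per proposition, and these are discarded. -/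
theorem runs_load {n m : ℕ} (adj : Fin n → Fin n → Bool) (lab : Fin m → Fin n → Bool)
    (rest : List Γ') :
    Runs load { inp := writeBlock (rowsOf adj) ++ (writeBlock (rowsOf lab) ++ rest) }
      (ready adj lab rest fun _ => Cell.empty)
      (7 * (flat (rowsOf adj)).length + 7 * (flat (rowsOf lab)).length + 12) := by
  refine ((runs_readBlock (rowsOf adj) _ _ rfl).seq
    ((Runs.move (j := .buf) (k := .mat) (by decide) id _).seq
    ((Runs.move (j := .ctr) (k := .x) (by decide) id _).seq
    ((runs_readBlock (rowsOf lab) rest _ (by rfl)).seq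
    ((Runs.move (j := .buf) (k := .lab) (by decide) id _).seq
    (Runs.clear _ .ctr)))))).conv ?_ ?_
  · simp [Mem.set, Mem.store, ready, List.ofFn_const]
  · have h1 := length_le_length_flat (rowsOf adj)
    have h2 := length_le_length_flat (rowsOf lab)
    simp at h1 h2
    simp [Mem.set, Mem.store]
    omega

/-- The decision procedure; `op` tells how to evaluate the cells after each goal. -/
def decideProg (op : Cell → Cell) : StackProg Alph :=
  .seq load (.seq (select Cell.setPre) (.seq (select Cell.setPost) (.seq (goalsProg op)
    (.seq (.push .out true) (.seq answer (.seq (.clear .mat) (.clear .lab)))))))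

/-- The cells before the first goal is processed. -/
def initCells {n m : ℕ} (lab : Fin m → Fin n → Bool) (goal : Goal (Fin m)) (s : Fin n) : Cell where
  inPre := lab goal.pre s
  inPost := lab goal.post s
  fromBad := !lab goal.pre s
  fromAny := true
  viol := false

/-- The encoding contains the matrix, the labeling and the goals, so its length bounds all three
sizes. The matrix and the labels are cleared at the end because a halting machine must leave only
the output stack non-empty. -/
theorem runs_decideProg {n m : ℕ} (adj : Fin n → Fin n → Bool) (lab : Fin m → Fin n → Bool)
    (op : Cell → Cell) (goal : Goal (Fin m)) (gs : List (Goal (Fin m))) {N : ℕ}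
    (hN : (writeBlock (rowsOf adj) ++ writeBlock (rowsOf lab) ++
      writeBlock (goalRows (goal :: gs))).length ≤ N) :
    Runs (decideProg op)
      { inp := writeBlock (rowsOf adj) ++ writeBlock (rowsOf lab) ++
          writeBlock (goalRows (goal :: gs)) }
      { out := [decide (∀ s, (gs.foldl (goalCells adj lab op) (initCells lab goal) s).viol = false)] }
      (N * (goalTime N + 2) + 100 * N + 100) := by
  simp only [List.length_append, length_writeBlock] at hN
  have hn : n ≤ (flat (rowsOf adj)).length := by
    simpa using length_le_length_flat (rowsOf adj)
  -- Each goal contributes two rows.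
  have hgs : gs.length ≤ (flat (goalRows (goal :: gs))).length := by
    refine le_trans ?_ (length_le_length_flat _)
    simp [goalRows]; omega
  rw [List.append_assoc]
  refine ((runs_load adj lab _).seq ((runs_select_ready adj lab Cell.setPre goal.pre _ _).seq
    ((runs_select_ready adj lab Cell.setPost goal.post _ _).seq
    ((runs_goalsProg (N := N) (by omega) (by omega) (by omega) op gs (initCells lab goal)).seq
    ((Runs.push _ .out true).seq ((runs_answer _ _ true (by rfl) (by rfl)).seq
    ((Runs.clear _ .mat).seq (Runs.clear _ .lab)))))))).conv ?_ ?_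
  · simp [Mem.set, ready]
    rw [Bool.eq_iff_iff]
    simp [List.all_eq_true]
  · have := Nat.mul_le_mul_right (goalTime N + 2) (show gs.length ≤ N by omega)
    simp [Mem.set, Mem.store, ready]
    omega

end UnderMatch

namespace UnderMatch

/-! ### Correctness of the decision procedure -/

/-- The cells `ξ` describe the sets of states `P`, `Q`, `A`, `B`, `V`. -/
structure Marks {n : ℕ} (P Q A B V : Set (Fin n)) (ξ : Fin n → Cell) : Prop where
  inPre : ∀ s, (ξ s).inPre = true ↔ s ∈ P
  inPost : ∀ s, (ξ s).inPost = true ↔ s ∈ Q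
  fromBad : ∀ s, (ξ s).fromBad = true ↔ s ∈ A
  fromAny : ∀ s, (ξ s).fromAny = true ↔ s ∈ B
  viol : ∀ s, (ξ s).viol = true ↔ s ∈ V

/-- Note in a cell whether a violation of the inclusion for `SAND` ends in the state. -/
def Cell.sandOp (c : Cell) : Cell :=
  { c with viol := c.fromBad || (c.fromAny && !c.inPost) }

/-- Note in a cell whether a violation of the inclusion for one more goal under `OR` ends in the
state, and prepare the cell for the next goal. -/
def Cell.orOp (c : Cell) : Cell :=
  { c with
    viol := c.viol || (c.fromBad || (c.fromAny && !c.inPost))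
    fromBad := !c.inPre
    fromAny := true }

section

variable {n m : ℕ} (T : TransitionSystem (Fin n) (Fin m)) {adj : Fin n → Fin n → Bool}
  {lab : Fin m → Fin n → Bool} {P Q A B V : Set (Fin n)} {ξ : Fin n → Cell}

theorem Marks.stepCells (hadj : ∀ s t, adj s t = true ↔ (s, t) ∈ T.trans) (h : Marks P Q A B V ξ) :
    Marks P Q (T.expand A) (T.expand B) V (stepCells adj ξ) where
  inPre := h.inPre
  inPost := h.inPost
  fromBad s := by
    simp [UnderMatch.stepCells, TransitionSystem.expand, h.fromBad, hadj, and_comm]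
  fromAny s := by
    simp [UnderMatch.stepCells, TransitionSystem.expand, h.fromAny, hadj, and_comm]
  viol := h.viol

theorem Marks.reach (hadj : ∀ s t, adj s t = true ↔ (s, t) ∈ T.trans) (h : Marks P Q A B V ξ) :
    Marks P Q (T.reach A) (T.reach B) V ((UnderMatch.stepCells adj)^[n] ξ) := by
  have key : ∀ k, Marks P Q (T.expand^[k] A) (T.expand^[k] B) V
      ((UnderMatch.stepCells adj)^[k] ξ) := by
    intro k
    induction k with
    | zero => exact h
    | succ k ih =>
      simp only [Function.iterate_succ_apply']
      exact ih.stepCells T hadj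
  have := key n
  rwa [T.iterate_expand_eq_reach _ (by simp), T.iterate_expand_eq_reach _ (by simp)] at this

theorem Marks.restrict {r : Fin n → Bool} {L : Set (Fin n)} (hr : ∀ s, r s = true ↔ s ∈ L)
    (h : Marks P Q A B V ξ) :
    Marks P Q (A ∩ L) (B ∩ L) V fun s => (ξ s).restrict (r s) where
  inPre := h.inPre
  inPost := h.inPost
  fromBad s := by simp [Cell.restrict, h.fromBad, hr]
  fromAny s := by simp [Cell.restrict, h.fromAny, hr]
  viol := h.viol

/-- The old violations `V` are overwritten, so only the images after the last goal decide. -/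
theorem Marks.sandOp (h : Marks P Q A B V ξ) :
    Marks P Q A B (A ∪ B \ Q) fun s => (ξ s).sandOp where
  inPre := h.inPre
  inPost := h.inPost
  fromBad := h.fromBad
  fromAny := h.fromAny
  viol s := by
    rw [Set.mem_union, Set.mem_sdiff, ← h.fromBad, ← h.fromAny, ← h.inPost]
    simp [Cell.sandOp]

/-- Violations accumulate, while the propagated sets return to their initial values so that the next
goal is treated on its own. The reset is possible because the cell still records `P`. -/
theorem Marks.orOp (h : Marks P Q A B V ξ) :
    Marks P Q Pᶜ Set.univ (V ∪ (A ∪ B \ Q)) fun s => (ξ s).orOp where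
  inPre := h.inPre
  inPost := h.inPost
  fromBad s := by
    rw [Set.mem_compl_iff, ← h.inPre]
    simp [Cell.orOp]
  fromAny s := by simp [Cell.orOp]
  viol s := by
    rw [Set.mem_union, Set.mem_union, Set.mem_sdiff, ← h.viol, ← h.fromBad, ← h.fromAny,
      ← h.inPost]
    simp [Cell.orOp]

theorem Marks.image (hadj : ∀ s t, adj s t = true ↔ (s, t) ∈ T.trans)
    (hlab : ∀ p s, lab p s = true ↔ s ∈ T.label p) (h : Marks P Q A B V ξ) (g : Goal (Fin m)) :
    Marks P Q (T.image g A) (T.image g B) V (goalCells adj lab id ξ g) :=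
  ((h.restrict (hlab g.pre)).reach T hadj).restrict (hlab g.post)

theorem marks_initCells (hlab : ∀ p s, lab p s = true ↔ s ∈ T.label p) (goal : Goal (Fin m)) :
    Marks (T.label goal.pre) (T.label goal.post) (T.label goal.pre)ᶜ Set.univ ∅
      (initCells lab goal) where
  inPre := hlab _
  inPost := hlab _
  fromBad s := by
    rw [Set.mem_compl_iff, ← hlab]
    simp [initCells]
  fromAny s := by simp [initCells]
  viol s := by simp [initCells]

theorem marks_foldl_sandOp (hadj : ∀ s t, adj s t = true ↔ (s, t) ∈ T.trans)
    (hlab : ∀ p s, lab p s = true ↔ s ∈ T.label p) (h : Marks P Q A B V ξ) (g : Goal (Fin m))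
    (gs : List (Goal (Fin m))) :
    Marks P Q (T.imageList A (g :: gs)) (T.imageList B (g :: gs))
      (T.imageList A (g :: gs) ∪ T.imageList B (g :: gs) \ Q)
      ((g :: gs).foldl (goalCells adj lab Cell.sandOp) ξ) := by
  -- By definition, `goalCells` with an operation is that operation applied after `goalCells` with
  -- `id`.
  have h' := (h.image T hadj hlab g).sandOp
  induction gs generalizing A B V ξ g with
  | nil => exact h'
  | cons g' gs ih => exact ih h' g' (h'.image T hadj hlab g').sandOp

theorem marks_foldl_orOp (hadj : ∀ s t, adj s t = true ↔ (s, t) ∈ T.trans)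
    (hlab : ∀ p s, lab p s = true ↔ s ∈ T.label p) (gs : List (Goal (Fin m)))
    (h : Marks P Q Pᶜ Set.univ V ξ) :
    Marks P Q Pᶜ Set.univ
      (V ∪ {s | ∃ g ∈ gs, s ∈ T.image g Pᶜ ∪ T.image g Set.univ \ Q})
      (gs.foldl (goalCells adj lab Cell.orOp) ξ) := by
  induction gs generalizing V ξ with
  | nil => simpa using h
  | cons g gs ih =>
    have := ih (h.image T hadj hlab g).orOp
    rw [List.foldl_cons]
    refine Eq.mp (congrArg (fun V => Marks P Q Pᶜ Set.univ V _) ?_) this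
    ext s
    simp only [List.mem_cons, exists_eq_or_imp, Set.mem_union, Set.mem_ofPred_eq, or_assoc]

theorem sandSem_subset_iff_viol (hadj : ∀ s t, adj s t = true ↔ (s, t) ∈ T.trans)
    (hlab : ∀ p s, lab p s = true ↔ s ∈ T.label p) (goal g : Goal (Fin m))
    (gs : List (Goal (Fin m))) :
    T.sandSem g gs ⊆ T.goalSem goal ↔
      ∀ s, ((g :: gs).foldl (goalCells adj lab Cell.sandOp) (initCells lab goal) s).viol = false := by
  rw [T.sandSem_subset_iff_imageList]
  refine forall_congr' fun s => ?_
  rw [← Bool.not_eq_true,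
    (marks_foldl_sandOp T hadj hlab (marks_initCells T hlab goal) g gs).viol]
  simp

theorem orSem_subset_iff_viol (hadj : ∀ s t, adj s t = true ↔ (s, t) ∈ T.trans)
    (hlab : ∀ p s, lab p s = true ↔ s ∈ T.label p) (goal g : Goal (Fin m))
    (gs : List (Goal (Fin m))) :
    T.orSem g gs ⊆ T.goalSem goal ↔
      ∀ s, ((g :: gs).foldl (goalCells adj lab Cell.orOp) (initCells lab goal) s).viol = false := by
  have h : ∀ g, T.goalSem g ⊆ T.goalSem goal ↔ ∀ s,
      s ∉ T.image g (T.label goal.pre)ᶜ ∪ T.image g Set.univ \ T.label goal.post := fun g => by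
    -- A single goal is a `SAND` of length one, so the criterion for `SAND` applies to each goal
    -- under `OR`.
    rw [show T.goalSem g = T.sandSem g [] from rfl, T.sandSem_subset_iff_imageList]
    refine forall_congr' fun s => ?_
    simp [TransitionSystem.imageList]
  rw [T.orSem_subset_iff_forall]
  simp only [h, ← Bool.not_eq_true,
    (marks_foldl_orOp T hadj hlab (g :: gs) (marks_initCells T hlab goal)).viol]
  constructor
  · rintro h s (hs | ⟨g', hg, hs⟩)
    · exact hs
    · exact h g' hg s hs
  · exact fun h g' hg s hs => h s (Or.inr ⟨g', hg, hs⟩)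

end

/-! ### The decision procedure is in PTIME -/

theorem store_inp (l : List Computability.Γ') :
    Mem.store { inp := l } = StackProg.single (Γ := Alph) .inp l := by
  rw [StackProg.single]
  funext k
  cases k <;> rfl

theorem store_out (l : List Bool) :
    Mem.store { out := l } = StackProg.single (Γ := Alph) .out l := by
  rw [StackProg.single]
  funext k
  cases k <;> rfl

-- The program depends on `op` alone and not on the input; the Boolean matrices chosen classically
-- serve only to describe the encoded string and the answer.
open Polynomial in
theorem inPTIME_of_op (op : Cell → Cell) (R : UnderMatchInput → Prop)
    (h : ∀ (I : UnderMatchInput) (adj : Fin I.n → Fin I.n → Bool) (lab : Fin I.m → Fin I.n → Bool),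
      (∀ s t, adj s t = true ↔ (s, t) ∈ I.T.trans) → (∀ p s, lab p s = true ↔ s ∈ I.T.label p) →
      (R I ↔ ∀ s, ((I.first :: I.rest).foldl (goalCells adj lab op)
        (initCells lab I.goal) s).viol = false)) :
    InPTIME UnderMatchInput.encode R := by
  classical
  refine InPTIME.of_runs (Γ := Alph) (inp := .inp) (out := .out) rfl _ _ (decideProg op)
    -- This is the bound of `runs_decideProg`, with `goalTime` unfolded and `N` the length of the
    -- encoding.
    (X * (X * (21 * X + 20) + 28 * X + 28) + 100 * X + 100 : ℕ[X]) fun I => ?_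
  let adj : Fin I.n → Fin I.n → Bool := fun s t => decide ((s, t) ∈ I.T.trans)
  let lab : Fin I.m → Fin I.n → Bool := fun p s => decide (s ∈ I.T.label p)
  refine ⟨decide (∀ s, ((I.first :: I.rest).foldl (goalCells adj lab op)
    (initCells lab I.goal) s).viol = false), ?_, ?_⟩
  · rw [decide_eq_true_iff, h I adj lab (by simp [adj]) (by simp [lab])]
  · have henc : UnderMatchInput.encode I = UnderMatchInput.writeBlock (rowsOf adj) ++
        UnderMatchInput.writeBlock (rowsOf lab) ++
        UnderMatchInput.writeBlock (goalRows (I.goal :: I.first :: I.rest)) := by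
      unfold UnderMatchInput.encode UnderMatchInput.matrixRows UnderMatchInput.labelRows rowsOf
      congr!
    have hr := (runs_decideProg adj lab op I.goal (I.first :: I.rest)
      (N := (UnderMatchInput.encode I).length) (by rw [henc])).conv rfl le_rfl
    rw [Runs, ← henc, store_inp, store_out] at hr
    refine hr.mono ?_
    simp [goalTime, Nat.add_assoc]

end UnderMatch

/-! ### The proposition -/

theorem proposition5 :
    -- OR: decidable in polynomial time
    InPTIME UnderMatchInput.encode UnderMatchInput.OrUnderMatch ∧
    -- SAND: decidable in polynomial time
    InPTIME UnderMatchInput.encode UnderMatchInput.SandUnderMatch ∧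
    -- OR: reduction to inclusions of sets of labeled states
    (∀ {S AP : Type*} [Finite S] (T : TransitionSystem S AP) (goal g : Goal AP)
        (gs : List (Goal AP)),
      T.orSem g gs ⊆ T.goalSem goal ↔
        ∀ h ∈ g :: gs,
          T.label h.pre ∩ T.coreach (T.label h.post) ⊆ T.label goal.pre ∧
          T.label h.post ∩ T.reach (T.label h.pre) ⊆ T.label goal.post) ∧
    -- SAND: reduction to emptiness of the state set of a formula
    (∀ {S AP : Type*} [Finite S] (T : TransitionSystem S AP) (goal g : Goal AP)
        (gs : List (Goal AP)),
      T.sandSem g gs ⊆ T.goalSem goal ↔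
        (EFFormula.sandFormula goal g gs).sem T = ∅) := by
  refine ⟨?_, ?_, ?_, ?_⟩
  · exact UnderMatch.inPTIME_of_op UnderMatch.Cell.orOp _ fun I adj lab hadj hlab =>
      UnderMatch.orSem_subset_iff_viol I.T hadj hlab I.goal I.first I.rest
  · exact UnderMatch.inPTIME_of_op UnderMatch.Cell.sandOp _ fun I adj lab hadj hlab =>
      UnderMatch.sandSem_subset_iff_viol I.T hadj hlab I.goal I.first I.rest
  · intro S AP _ T goal g gs
    simp only [T.orSem_subset_iff_forall, T.goalSem_subset_iff]
  · intro S AP _ T goal g gs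
    exact T.sandSem_subset_iff_formula goal g gs
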